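/- Consider $N$ parties, where party $i$ holds $m_i$ fermionic modes, and suppose that no party holds more modes than all the others together: $m_i\le\sum_{j\ne i}m_j$ for every $i$. The modes are ordered with those of the first party first, and so on; $\tilde c_1,\dots,\tilde c_{2n}$, $n=\sum_i m_i$, are the Majorana operators on the Fock space. Definitions. A unit vector $|\Psi\rangle$ is a pure fermionic state (FS) if $|\Psi\rangle\langle\Psi|$ commutes with the parity operator. It is fully entangled if for each $i$ its Schmidt decomposition (in the Jordan–Wigner representation) with respect to the splitting of party $i$ versus the rest has no zero Schmidt coefficient, i.e. has $\min(2^{m_i},2^{n-m_i})$ nonzero ones. A Gaussian state is a normalised operator $K\exp(-\tfrac i4\sum_{k,l}G_{kl}\tilde c_k\tilde c_l)$ with $G$ real antisymmetric, or a limit of such operators; the covariance matrix of $\rho$ is $\gamma_{kl}=-\tfrac1{2i}\mathrm{tr}(\rho[\tilde c_k,\tilde c_l])$. The Choi–Jamiołkowski (CJ) state of a linear map $\mathcal E$ on operators is $\mathcal E\,\tilde\otimes\,\mathrm{id}\,(|\Phi^+\rangle\langle\Phi^+|)$ with $|\Phi^+\rangle\langle\Phi^+|=\prod_{a=1}^{2n}\tfrac12(1+i\tilde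 c_a\tilde c_{2n+a})$, and $\mathcal E$ is Gaussian if this state is Gaussian. A Gaussian separable map (GSEP) is a completely positive trace-preserving Gaussian map for which the covariance matrix of the CJ state is a direct sum over the parties (party $i$ holding its modes and their copies). A Gaussian local unitary (GLU) of party $i$ is a unitary $U_i$ in the algebra generated by the Majorana operators of party $i$ such that $U_i^\dagger\tilde c_jU_i=\sum_kO_{jk}\tilde c_k$ for the Majorana operators of party $i$, with $O\in \mathrm O(2m_i,\mathbb R)$. An operator $x$ is Gaussian if it has definite parity (it commutes or anticommutes with the parity operator) and $[\Lambda,x\otimes x]=0$, $\Lambda=\sum_a\tilde c_a\otimes\tilde c_a$. GLOCC is the set of Gaussian maps that are realised by finitely many rounds of local measurements with classical communication, whose measurement operators are Gaussian operators on the modes of the acting party, or that are limits of maps so realised. Lemma. Let $|\Psi\rangle$ and $|\Phi\rangle$ be pure fully entangled $m_1\times\dots\times m_N$-mode FS. (a) If $\mathcal E_{sep}$ is a GSEP map with $\mathcal E_{sep}(|\Psi\rangle\langle\Psi|)=|\Phi\rangle\langle\Phi|$, then there are GLUs $U_i$ of the parties $i=1,\dots,N$ such that, with $V=U_1U_2\cdots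 U_N$, $\mathcal E_{sep}(\rho)=V\rho V^\dagger$ for all operators $\rho$. (b) Consequently, GLOCC among such states (in particular among pure fully entangled Gaussian states) is trivial: any GLOCC map $\mathcal E$ with $\mathcal E(|\Psi\rangle\langle\Psi|)=|\Phi\rangle\langle\Phi|$ is likewise of the form $\rho\mapsto V\rho V^\dagger$ with $V$ a product of GLUs, one for each party. -/

import Mathlib

open scoped Kronecker Matrix BigOperators Topology ComplexOrder

noncomputable section

namespace Fermion

/-! ## Fock space of a finite ordered set of modes

The Fock basis state `|S⟩`, for `S` a finite set of modes, is the ordered product of the creation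
operators of the modes in `S`, applied to the vacuum.  A vector is a function of `S`, an operator
is a matrix. -/

/-- Operators on the Fock space over the modes `M`. -/
abbrev Op (M : Type) : Type := Matrix (Finset M) (Finset M) ℂ

/-- Index set of the Majorana operators: two per mode. -/
abbrev MajIdx (M : Type) : Type := M × Fin 2

/-- The annihilation operator `b_k`: `b_k |S⟩ = (-1)^{#{l ∈ S : l < k}} |S \ {k}⟩` if `k ∈ S`,
and `b_k |S⟩ = 0` otherwise. -/
def annihilation {M : Type} [LinearOrder M] (k : M) : Op M :=
  Matrix.of fun T S =>
    if k ∈ S ∧ T = S.erase k then (-1 : ℂ) ^ (S.filter (fun l => l < k)).card else 0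

/-- The Majorana operators `c_{(k,0)} = b_k + b_k†` and `c_{(k,1)} = -i (b_k - b_k†)`. -/
def majorana {M : Type} [LinearOrder M] (a : MajIdx M) : Op M :=
  if a.2 = 0 then annihilation a.1 + (annihilation a.1)ᴴ
  else (-Complex.I) • (annihilation a.1 - (annihilation a.1)ᴴ)

/-- The parity operator `P = (-1)^{∑ n_k}`. -/
def parity (M : Type) [LinearOrder M] : Op M :=
  Matrix.diagonal fun S => (-1 : ℂ) ^ S.card

/-- Operators of definite parity: even (commuting with `P`) or odd (anticommuting with `P`). -/
def HasDefiniteParity {M : Type} [LinearOrder M] [Fintype M] (x : Op M) : Prop :=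
  x * parity M = parity M * x ∨ x * parity M = -(parity M * x)

/-- The rank-one operator `|ψ⟩⟨ψ|`. -/
def proj {M : Type} (ψ : EuclideanSpace ℂ (Finset M)) : Op M :=
  Matrix.of fun S T => ψ S * star (ψ T)

/-- Pure fermionic states: unit vectors whose density operator commutes with the parity. -/
def IsPureFermionic {M : Type} [LinearOrder M] [Fintype M]
    (ψ : EuclideanSpace ℂ (Finset M)) : Prop :=
  ‖ψ‖ = 1 ∧ Commute (proj ψ) (parity M)

/-! ## Gaussian states and covariance matrices

These two notions are stated for an arbitrary finite family `c` of Majorana operators, because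
they are used on the doubled system below. -/

/-- Gaussian fermionic states: normalised operators `K exp(-(i/4) ∑ G_{kl} c_k c_l)` with `G` real
antisymmetric, and limits of such operators. -/
def IsGaussianState {ι n : Type} [Fintype ι] [Fintype n] [DecidableEq n]
    (c : ι → Matrix n n ℂ) (ρ : Matrix n n ℂ) : Prop :=
  ρ ∈ closure {σ : Matrix n n ℂ | ∃ (G : Matrix ι ι ℝ) (K : ℝ), Gᵀ = -G ∧ σ.trace = 1 ∧
    σ = (K : ℂ) • NormedSpace.exp
      ((-(Complex.I / 4)) • ∑ k, ∑ l, (G k l : ℂ) • (c k * c l))}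

/-- The covariance matrix `γ_{kl} = -(1/(2i)) tr(ρ [c_k, c_l])`. -/
def covariance {ι n : Type} [Fintype n] (c : ι → Matrix n n ℂ) (ρ : Matrix n n ℂ) :
    Matrix ι ι ℂ :=
  Matrix.of fun k l => -(1 / (2 * Complex.I)) * (ρ * (c k * c l - c l * c k)).trace

/-! ## Maps and the Choi–Jamiołkowski state -/

/-- Linear maps on the operators on Fock space. -/
abbrev SuperOp (M : Type) : Type := Op M →ₗ[ℂ] Op M

/-- The map `E ⊗ id`, with an ancilla space with basis `R`. -/
def ampliation {M R : Type} (E : SuperOp M) (X : Matrix (Finset M × R) (Finset M × R) ℂ) :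
    Matrix (Finset M × R) (Finset M × R) ℂ :=
  Matrix.of fun p q => E (Matrix.of fun S T => X (S, p.2) (T, q.2)) p.1 q.1

/-- Completely positive trace-preserving maps. -/
def IsCPTP {M : Type} [Fintype M] (E : SuperOp M) : Prop :=
  (∀ (d : ℕ) (X : Matrix (Finset M × Fin d) (Finset M × Fin d) ℂ),
    X.PosSemidef → (ampliation E X).PosSemidef) ∧
  ∀ X : Op M, (E X).trace = X.trace

/-- The Majorana operators of the doubled system, which consists of the modes `M` (the system,
`Sum.inl`) followed by a copy of them (the ancilla, `Sum.inr`), in the Jordan–Wigner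
representation: `c ⊗ 1` for the system and `P ⊗ c` for the ancilla. -/
def doubledMajorana {M : Type} [LinearOrder M] :
    MajIdx M ⊕ MajIdx M → Matrix (Finset M × Finset M) (Finset M × Finset M) ℂ
  | Sum.inl a => majorana a ⊗ₖ (1 : Op M)
  | Sum.inr a => parity M ⊗ₖ majorana a

/-- The maximally entangled state `|Φ⁺⟩⟨Φ⁺| = ∏_a (1 + i c_a c'_a) / 2` of system and ancilla,
the product being over all Majorana operators `c_a` of the system, with `c'_a` the corresponding
ones of the ancilla.  The factors commute, so the order in the product is immaterial. -/
def maxEntangled (M : Type) [LinearOrder M] [Fintype M] :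
    Matrix (Finset M × Finset M) (Finset M × Finset M) ℂ :=
  ((Finset.univ : Finset (MajIdx M)).toList.map fun a =>
    (1 / 2 : ℂ) • (1 + Complex.I •
      (doubledMajorana (Sum.inl a) * doubledMajorana (Sum.inr a)))).prod

/-- The Choi–Jamiołkowski state of `E`. As the system precedes the ancilla in the Jordan–Wigner
order, the fermionic extension of `E` by the identity is the ordinary `E ⊗ id`. -/
def cjState {M : Type} [LinearOrder M] [Fintype M] (E : SuperOp M) :
    Matrix (Finset M × Finset M) (Finset M × Finset M) ℂ :=
  ampliation E (maxEntangled M)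

/-- Gaussian maps: those with a Gaussian Choi–Jamiołkowski state. -/
def IsGaussianMap {M : Type} [LinearOrder M] [Fintype M] (E : SuperOp M) : Prop :=
  IsGaussianState doubledMajorana (cjState E)

/-- `Λ (x ⊗ x) = (x ⊗ x) Λ` with `Λ = ∑_a c_a ⊗ c_a`, for an operator `x` of definite parity:
the Gaussian operators (even ones, and those composed with a parity flip). -/
def IsGaussianOperator {M : Type} [LinearOrder M] [Fintype M] (x : Op M) : Prop :=
  HasDefiniteParity x ∧
    Commute (∑ a : MajIdx M, majorana a ⊗ₖ majorana a) (x ⊗ₖ x)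

/-! ## Several parties

There are `N` parties, and party `i` holds `m i` modes. -/

section Parties

variable {N : ℕ}

/-- All modes, ordered lexicographically: those of the first party first, and so on. -/
abbrev Modes (m : Fin N → ℕ) : Type := Σₗ i : Fin N, Fin (m i)

/-- The mode `k` of party `i`. -/
def mode (m : Fin N → ℕ) (i : Fin N) (k : Fin (m i)) : Modes m := toLex ⟨i, k⟩

/-- The party that holds a mode. -/
def party {m : Fin N → ℕ} (k : Modes m) : Fin N := (ofLex k).1

/-- The Majorana operators of party `i`. -/
def localMajorana (m : Fin N → ℕ) (i : Fin N) (a : MajIdx (Fin (m i))) : Op (Modes m) :=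
  majorana (mode m i a.1, a.2)

/-- The operators acting on the modes of party `i`: the algebra generated by its Majorana
operators. -/
def localAlgebra (m : Fin N → ℕ) (i : Fin N) : Subalgebra ℂ (Op (Modes m)) :=
  Algebra.adjoin ℂ (Set.range (localMajorana m i))

/-- The number of modes that party `i` does not hold. -/
def modesOfRest (m : Fin N → ℕ) (i : Fin N) : ℕ := ∑ j ∈ Finset.univ.erase i, m j

/-- The modes not held by party `i`. -/
abbrev RestModes (m : Fin N → ℕ) (i : Fin N) : Type := {k : Modes m // party k ≠ i}

/-- The joint occupation of all modes, given that of party `i` and that of all the others. -/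
def jointOccupation (m : Fin N → ℕ) (i : Fin N) (S : Finset (Fin (m i)))
    (T : Finset (RestModes m i)) : Finset (Modes m) :=
  S.image (mode m i) ∪ T.image Subtype.val

/-- Fully entangled vectors: for each party, the Schmidt decomposition (in the Jordan–Wigner
representation) with respect to the splitting of this party versus the rest has no zero Schmidt
coefficient, i.e. all `min (2 ^ m i) (2 ^ modesOfRest m i)` of them are nonzero. -/
def IsFullyEntangled (m : Fin N → ℕ) (ψ : EuclideanSpace ℂ (Finset (Modes m))) : Prop :=
  ∀ i : Fin N, ∃ (lam : Fin (min (2 ^ m i) (2 ^ modesOfRest m i)) → ℝ)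
    (η : Fin (min (2 ^ m i) (2 ^ modesOfRest m i)) → EuclideanSpace ℂ (Finset (Fin (m i))))
    (ν : Fin (min (2 ^ m i) (2 ^ modesOfRest m i)) → EuclideanSpace ℂ (Finset (RestModes m i))),
    (∀ j, 0 < lam j) ∧ Orthonormal ℂ η ∧ Orthonormal ℂ ν ∧
    ∀ S T, ψ (jointOccupation m i S T) = ∑ j, (lam j : ℂ) * (η j S * ν j T)

/-- Gaussian separable maps (GSEP): completely positive trace-preserving Gaussian maps for which
the covariance matrix of the Choi–Jamiołkowski state is a direct sum over the parties, where party
`i` holds its modes of the system and the copies of them in the ancilla. -/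
def IsGSEP (m : Fin N → ℕ) (E : SuperOp (Modes m)) : Prop :=
  IsCPTP E ∧ IsGaussianMap E ∧
  ∀ k l : MajIdx (Modes m) ⊕ MajIdx (Modes m),
    party (Sum.elim Prod.fst Prod.fst k) ≠ party (Sum.elim Prod.fst Prod.fst l) →
      covariance doubledMajorana (cjState E) k l = 0

/-- Gaussian local unitaries of party `i`: unitaries on the modes of party `i` that effect a real
orthogonal transformation of its Majorana operators. -/
def IsGaussianLocalUnitary (m : Fin N → ℕ) (i : Fin N) (U : Op (Modes m)) : Prop :=
  U ∈ localAlgebra m i ∧ U ∈ Matrix.unitaryGroup (Finset (Modes m)) ℂ ∧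
  ∃ O ∈ Matrix.orthogonalGroup (MajIdx (Fin (m i))) ℝ,
    ∀ a, Uᴴ * localMajorana m i a * U = ∑ b, (O a b : ℂ) • localMajorana m i b

/-- `E` acts on every operator as conjugation with a product of Gaussian local unitaries, one for
each party. -/
def IsProductOfGLU (m : Fin N → ℕ) (E : SuperOp (Modes m)) : Prop :=
  ∃ U : Fin N → Op (Modes m), (∀ i, IsGaussianLocalUnitary m i (U i)) ∧
    ∀ ρ : Op (Modes m), E ρ = (List.ofFn U).prod * ρ * ((List.ofFn U).prod)ᴴ

/-- Protocols of local measurements with classical communication and finitely many rounds: in each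
round one party `i` measures with measurement operators `A 0, …, A (K - 1)`, announces the outcome,
and the remaining protocol may depend on it. -/
inductive Protocol (m : Fin N → ℕ) : Type
  | halt : Protocol m
  | round (i : Fin N) (K : ℕ) (A : Fin K → Op (Modes m)) (next : Fin K → Protocol m) : Protocol m

/-- In each round the measurement operators are Gaussian operators on the modes of the acting
party and satisfy the completeness relation. -/
def Protocol.IsGaussianLocal {m : Fin N → ℕ} : Protocol m → Prop
  | .halt => True
  | .round i _ A next =>
      (∀ k, A k ∈ localAlgebra m i ∧ IsGaussianOperator (A k)) ∧
      ∑ k, (A k)ᴴ * A k = 1 ∧ ∀ k, (next k).IsGaussianLocal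

/-- The state of the system at the end of the protocol, averaged over the outcomes. -/
def Protocol.run {m : Fin N → ℕ} : Protocol m → Op (Modes m) → Op (Modes m)
  | .halt, ρ => ρ
  | .round _ _ A next, ρ => ∑ k, (next k).run (A k * ρ * (A k)ᴴ)

/-- GLOCC: Gaussian maps that are realised by Gaussian local operations and finitely many rounds
of classical communication, or that are limits of maps so realised. -/
def IsGLOCC (m : Fin N → ℕ) (E : SuperOp (Modes m)) : Prop :=
  IsGaussianMap E ∧ ∃ p : ℕ → Protocol m, (∀ r, (p r).IsGaussianLocal) ∧
    ∀ ρ : Op (Modes m), Filter.Tendsto (fun r => (p r).run ρ) Filter.atTop (𝓝 (E ρ))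

end Parties

end Fermion

end

/-! Let F be the Heisenberg dual of E, P the parity, ρ the CJ state and C_kl = tr(ρ c_k c_l)
(`corr`). Gaussianity gives [Λ, ρ ⊗ ρ] = 0; tracing this against X ⊗ c_b yields a recursive Wick
theorem (`GaussianProperties.wick`). Sliding ancilla operators through |Φ⁺⟩ turns it into recursions
for F: with F̃(Z) = F(ZP)P and g_b = F̃(c_b), which is a linear combination of Majorana operators,
2F(c_b Z) = Σ_a C_ba F({Z, c_a}) − [F̃(Z), g_b], and there is a companion formula for F̃
(`two_smul_dualMap_majorana_mul`, `two_smul_twistedDualMap_majorana_mul`).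

Purity of the states φ = Φ, ψ = Ψ enters through complete positivity: Zφ = 0 implies F(Z)ψ = 0, so
F(Z)ψ depends only on Zφ. Since no party holds more modes than the rest, full entanglement of φ lets
any vector be written Yφ with Y anticommuting with all Majorana operators of a chosen party
(`exists_anticommuting_mulVec`). Take the party of c_b and Yφ = c_d φ. As C is block diagonal, the
recursion collapses to F(c_b Y) = g_b F̃(Y), so F(c_b c_d)ψ = g_b g_d ψ. The recursion at Z = c_d
also gives 2F(c_b c_d) = 2C_bd − [g_d, g_b]. Hence 2C_bd = {g_b, g_d} is symmetric in b and d, while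
the anticommutation relations give C_bd + C_db = 2δ_bd. So C is the identity on the system, and g_b
= Σ_a O_ba c_a with O orthogonal and block diagonal over the parties.

The recursions now determine F completely, and F(X) = V†XV for any unitary V implementing O up to a
suitable sign. Writing each block of O as a product of reflections provides such a V as a product of
GLUs.

For (b), a local operator of definite parity commutes or anticommutes with the parity of every
single party. A GLOCC map is therefore covariant under these local parities, which kills all
correlations between different parties; complete positivity and trace preservation pass to limits.
So GLOCC maps are GSEP (`IsGLOCC.isGSEP`) and (a) applies. -/

namespace Fermion

/-! ## Majorana operators as monomial matrices -/

section Fock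

variable {M : Type} [LinearOrder M]

/-- The diagonal operator with the multiplicative function of the occupied modes defined by `e`. -/
noncomputable def charOp (e : M → ℂ) : Op M := Matrix.diagonal fun S => ∏ l ∈ S, e l

/-- The sign picked up by the Majorana operator `a` from the mode `l`. -/
noncomputable def majoranaSign (a : MajIdx M) (l : M) : ℂ :=
  if l < a.1 ∨ (l = a.1 ∧ a.2 ≠ 0) then -1 else 1

/-- The nonzero matrix element of a Majorana operator in the column `S`. -/
noncomputable def majoranaWeight (a : MajIdx M) (S : Finset M) : ℂ :=
  (if a.2 = 0 then 1 else Complex.I) * ∏ l ∈ S, majoranaSign a l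

theorem majoranaSign_mul_self (a : MajIdx M) (l : M) :
    majoranaSign a l * majoranaSign a l = 1 := by
  unfold majoranaSign; split_ifs <;> norm_num

theorem prod_symmDiff_singleton (e : M → ℂ) (k : M) (he : e k * e k = 1) (S : Finset M) :
    ∏ l ∈ symmDiff S {k}, e l = e k * ∏ l ∈ S, e l := by
  by_cases hk : k ∈ S
  · have : symmDiff S {k} = S.erase k := by
      ext l; by_cases h : l = k <;> simp [Finset.mem_symmDiff, h, hk]
    rw [this, ← Finset.mul_prod_erase S e hk, ← mul_assoc, he, one_mul]
  · have : symmDiff S {k} = insert k S := by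
      ext l; by_cases h : l = k <;> simp [Finset.mem_symmDiff, h, hk]
    rw [this, Finset.prod_insert hk]

theorem majoranaWeight_symmDiff (a : MajIdx M) (k : M) (S : Finset M) :
    majoranaWeight a (symmDiff S {k}) = majoranaSign a k * majoranaWeight a S := by
  unfold majoranaWeight
  rw [prod_symmDiff_singleton _ _ (majoranaSign_mul_self a k)]; ring

theorem neg_one_pow_card_filter_lt (k : M) (S : Finset M) :
    (-1 : ℂ) ^ (S.filter (fun l => l < k)).card = ∏ l ∈ S, if l < k then (-1 : ℂ) else 1 := by
  simp [Finset.prod_ite]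

/-- A Majorana operator toggles one mode, so each column has one nonzero entry, coming from `b_k` or
its adjoint according to whether `k` is occupied. For the second Majorana operator these two
contributions carry −i and i; the relative sign is the value of `majoranaSign` at its own mode. -/
theorem majorana_apply (a : MajIdx M) (T S : Finset M) :
    majorana a T S = if T = symmDiff S {a.1} then majoranaWeight a S else 0 := by
  obtain ⟨k, r⟩ := a
  have hsign (S : Finset M) (hk : k ∉ S) :
      ∏ l ∈ S, majoranaSign (k, r) l = (-1 : ℂ) ^ (S.filter (fun l => l < k)).card := by
    rw [neg_one_pow_card_filter_lt]
    refine Finset.prod_congr rfl fun l hl => ?_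
    have : l ≠ k := fun h => hk (h ▸ hl)
    simp [majoranaSign, this]
  have hself : majoranaSign (k, r) k = if r = 0 then 1 else -1 := by
    simp only [majoranaSign, lt_irrefl, false_or, true_and, ne_eq]
    split_ifs <;> simp_all
  have hann : ∀ T S : Finset M, annihilation k T S =
      if k ∈ S ∧ T = S.erase k then (-1 : ℂ) ^ (S.filter (fun l => l < k)).card else 0 :=
    fun _ _ => rfl
  have hfilter (S : Finset M) :
      (S.erase k).filter (fun l => l < k) = S.filter (fun l => l < k) := by
    ext l; simp only [Finset.mem_filter, Finset.mem_erase]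
    exact ⟨fun h => ⟨h.1.2, h.2⟩, fun h => ⟨⟨h.2.ne, h.1⟩, h.2⟩⟩
  have key : majorana (k, r) T S = (if r = 0 then 1 else -Complex.I) * annihilation k T S +
      (if r = 0 then 1 else Complex.I) * star (annihilation k S T) := by
    unfold majorana
    by_cases hr : r = 0
    · simp [hr, Matrix.conjTranspose_apply]
    · simp [hr, Matrix.conjTranspose_apply]; ring
  rw [key, hann, hann, majoranaWeight]
  by_cases hk : k ∈ S
  · have h1 : symmDiff S {k} = S.erase k := by
      ext l; by_cases h : l = k <;> simp [Finset.mem_symmDiff, h, hk]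
    have h2 : ¬ (k ∈ T ∧ S = T.erase k) := fun h => by
      rw [h.2] at hk; simp at hk
    have h3 : ∏ l ∈ S, majoranaSign (k, r) l =
        (if r = 0 then 1 else -1) * (-1 : ℂ) ^ (S.filter (fun l => l < k)).card := by
      rw [← Finset.mul_prod_erase S _ hk, hsign _ (Finset.notMem_erase _ _), hself, hfilter]
    simp only [h1, hk, true_and, h2, if_false, star_zero, mul_zero, add_zero]
    rw [h3]
    split_ifs <;> simp
  · have h1 : symmDiff S {k} = insert k S := by
      ext l; by_cases h : l = k <;> simp [Finset.mem_symmDiff, h, hk]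
    have h2 : (k ∈ T ∧ S = T.erase k) ↔ T = insert k S := by
      constructor
      · rintro ⟨h, rfl⟩; rw [Finset.insert_erase h]
      · rintro rfl; simp [hk]
    simp only [h1, hk, false_and, if_false, mul_zero, zero_add, h2]
    rw [hsign S hk]
    by_cases hT : T = insert k S
    · have : T.filter (fun l => l < k) = S.filter (fun l => l < k) := by
        rw [← hfilter T, hT, Finset.erase_insert hk]
      rw [if_pos hT, if_pos hT, this]
      by_cases hr : r = 0 <;> simp [hr]
    · simp [hT]

theorem majorana_conjTranspose (a : MajIdx M) : (majorana a)ᴴ = majorana a := by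
  unfold majorana
  split_ifs
  · simp [add_comm]
  · simp [smul_sub]; abel

/-! ### The Clifford algebra generated by the Majorana operators. -/

variable [Fintype M]

theorem majorana_mul_apply (a b : MajIdx M) (T S : Finset M) :
    (majorana a * majorana b) T S = if T = symmDiff (symmDiff S {b.1}) {a.1} then
      majoranaSign a b.1 * (majoranaWeight a S * majoranaWeight b S) else 0 := by
  rw [Matrix.mul_apply, Finset.sum_eq_single (symmDiff S {b.1})]
  · rw [majorana_apply, majorana_apply, majoranaWeight_symmDiff, if_pos rfl]
    split_ifs <;> simp [mul_assoc]
  · intro U _ hU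
    rw [majorana_apply b, if_neg hU, mul_zero]
  · simp

theorem majorana_mul_self (a : MajIdx M) : majorana a * majorana a = 1 := by
  ext T S
  have hw : (∏ l ∈ S, majoranaSign a l) * ∏ l ∈ S, majoranaSign a l = 1 := by
    rw [← Finset.prod_mul_distrib]
    exact Finset.prod_eq_one fun l _ => majoranaSign_mul_self a l
  rw [majorana_mul_apply, symmDiff_symmDiff_cancel_right, Matrix.one_apply]
  by_cases h : T = S
  · simp only [h, if_true, majoranaWeight, majoranaSign]
    have := hw
    simp only [majoranaSign] at this
    by_cases hr : a.2 = 0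
    · simp [hr] at this ⊢; exact this
    · simp only [hr, lt_irrefl, if_false, false_or, true_and, not_false_eq_true, if_true, ne_eq]
        at this ⊢
      generalize (∏ x ∈ S, if x < a.1 ∨ x = a.1 ∧ True then (-1 : ℂ) else 1) = p at this ⊢
      linear_combination this - p * p * Complex.I_sq
  · simp [h]

/-- Of two different modes exactly one precedes the other, so exactly one of the operators picks up
a sign from toggling the other's mode. On a common mode the index in `Fin 2` plays the role of the
order. -/
theorem majorana_anticomm {a b : MajIdx M} (hab : a ≠ b) :
    majorana a * majorana b = -(majorana b * majorana a) := by
  ext T S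
  rw [Matrix.neg_apply, majorana_mul_apply, majorana_mul_apply, symmDiff_right_comm S {b.1} {a.1}]
  have hs : majoranaSign a b.1 = -majoranaSign b a.1 := by
    obtain ⟨k, r⟩ := a
    obtain ⟨l, s⟩ := b
    rcases lt_trichotomy k l with h | h | h
    · simp [majoranaSign, h, h.not_gt, h.ne']
    · subst h
      have : r ≠ s := fun h => hab (by rw [h])
      fin_cases r <;> fin_cases s <;> simp_all [majoranaSign]
    · simp [majoranaSign, h, h.not_gt, h.ne']
  split_ifs
  · rw [hs]; ring
  · simp

theorem majorana_mul_add (a b : MajIdx M) :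
    majorana a * majorana b + majorana b * majorana a = if a = b then 2 else 0 := by
  split_ifs with h
  · subst h; rw [majorana_mul_self]; norm_num
  · rw [majorana_anticomm h]; simp

theorem charOp_mul (e f : M → ℂ) : charOp e * charOp f = charOp (e * f) := by
  simp [charOp, Matrix.diagonal_mul_diagonal, Finset.prod_mul_distrib]

omit [Fintype M] in
theorem charOp_one : charOp (1 : M → ℂ) = 1 := by
  simp [charOp]

omit [Fintype M] in
theorem parity_eq : parity M = charOp (fun _ => (-1 : ℂ)) := by
  simp [parity, charOp]

/-- Toggling mode `k` multiplies a ±1-valued character by `e k`. The total parity and the parities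
of single parties are both of this kind. -/
theorem charOp_mul_majorana (e : M → ℂ) (he : ∀ k, e k * e k = 1) (a : MajIdx M) :
    charOp e * majorana a = e a.1 • (majorana a * charOp e) := by
  ext T S
  rw [charOp, Matrix.diagonal_mul, Matrix.smul_apply, Matrix.mul_diagonal, majorana_apply]
  split_ifs with h
  · rw [h, prod_symmDiff_singleton e a.1 (he _)]; simp; ring
  · simp

theorem charOp_mul_self (e : M → ℂ) (he : ∀ k, e k * e k = 1) : charOp e * charOp e = 1 := by
  rw [charOp_mul, show e * e = 1 from funext he, charOp_one]

theorem parity_mul_self : parity M * parity M = 1 := by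
  rw [parity_eq, charOp_mul_self]; simp

theorem parity_mul_majorana (a : MajIdx M) :
    parity M * majorana a = -(majorana a * parity M) := by
  rw [parity_eq, charOp_mul_majorana _ (by simp)]; simp

omit [Fintype M] in
theorem parity_conjTranspose : (parity M)ᴴ = parity M := by
  rw [parity, Matrix.diagonal_conjTranspose]; congr 1; ext S; simp

/-- The operator `-i c_{k,0} c_{k,1}` is `(-1)^{n_k}`. -/
theorem majorana_zero_mul_one (k : M) :
    majorana (k, 0) * majorana (k, 1) =
      Complex.I • charOp (fun l => if l = k then (-1 : ℂ) else 1) := by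
  ext T S
  rw [majorana_mul_apply, symmDiff_symmDiff_cancel_right, Matrix.smul_apply, charOp,
    Matrix.diagonal_apply]
  split_ifs with h
  · simp only [majoranaWeight, majoranaSign]
    have : ∀ l : M, (if l < k ∨ l = k ∧ (0 : Fin 2) ≠ 0 then (-1 : ℂ) else 1) *
        (if l < k ∨ l = k ∧ (1 : Fin 2) ≠ 0 then (-1 : ℂ) else 1) =
        if l = k then (-1 : ℂ) else 1 := by
      intro l
      rcases lt_trichotomy l k with h | h | h
      · simp [h, h.ne]
      · simp [h]
      · simp [h.not_gt, h.ne']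
    rw [h, ← Finset.prod_congr rfl fun l _ => this l, Finset.prod_mul_distrib]
    simp; ring
  · simp

theorem charOp_mem (A : Subalgebra ℂ (Op M)) (s : Finset M)
    (hA : ∀ k ∈ s, majorana (k, 0) * majorana (k, 1) ∈ A) :
    charOp (fun l => if l ∈ s then (-1 : ℂ) else 1) ∈ A := by
  induction s using Finset.induction_on with
  | empty => simpa using charOp_one (M := M) ▸ A.one_mem
  | insert k s hk ih =>
    have h1 : charOp (fun l => if l = k then (-1 : ℂ) else 1) ∈ A := by
      have := A.smul_mem (hA k (Finset.mem_insert_self _ _)) (-Complex.I)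
      rwa [majorana_zero_mul_one, smul_smul, neg_mul, Complex.I_mul_I, neg_neg, one_smul] at this
    have := A.mul_mem h1 (ih fun j hj => hA j (Finset.mem_insert_of_mem hj))
    rw [charOp_mul] at this
    convert this using 2
    ext l
    by_cases h : l = k
    · subst h; simp [hk]
    · simp [h]

theorem parity_mem (A : Subalgebra ℂ (Op M))
    (hA : ∀ k : M, majorana (k, 0) * majorana (k, 1) ∈ A) : parity M ∈ A := by
  have := charOp_mem A Finset.univ fun k _ => hA k
  simpa [parity_eq] using this

/-- The Majorana operators generate all operators. -/
theorem adjoin_majorana : Algebra.adjoin ℂ (Set.range (majorana (M := M))) = ⊤ := by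
  set A := Algebra.adjoin ℂ (Set.range (majorana (M := M)))
  have hmaj (a) : majorana a ∈ A := Algebra.subset_adjoin ⟨a, rfl⟩
  -- The projection onto the occupations agreeing with `S` at mode `k` is (1 ± (−1)^{n_k})/2.
  -- Multiplying over all modes gives a diagonal matrix unit, and Majorana operators then move its
  -- row index anywhere.
  have hchar (k : M) (S : Finset M) :
      (Matrix.diagonal fun T => if (k ∈ T ↔ k ∈ S) then (1 : ℂ) else 0) ∈ A := by
    have h1 := charOp_mem A {k} fun j _ => A.mul_mem (hmaj (j, 0)) (hmaj (j, 1))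
    have h2 : (Matrix.diagonal fun T => if (k ∈ T ↔ k ∈ S) then (1 : ℂ) else 0) =
        (1 / 2 : ℂ) • ((1 : Op M) + (if k ∈ S then (-1 : ℂ) else 1) •
          charOp (fun l => if l ∈ ({k} : Finset M) then (-1 : ℂ) else 1)) := by
      rw [charOp, ← Matrix.diagonal_one, ← Matrix.diagonal_smul, Matrix.diagonal_add,
        ← Matrix.diagonal_smul]
      congr 1
      ext T
      by_cases hT : k ∈ T <;> by_cases hS : k ∈ S <;> simp [hT, hS] <;> norm_num
    rw [h2]
    exact A.smul_mem (A.add_mem A.one_mem (A.smul_mem h1 _)) _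
  have hdiag (S : Finset M) (K : Finset M) :
      (Matrix.diagonal fun T => ∏ k ∈ K, if (k ∈ T ↔ k ∈ S) then (1 : ℂ) else 0) ∈ A := by
    induction K using Finset.induction_on with
    | empty => simp [A.one_mem]
    | insert k K hk ih =>
      have := A.mul_mem (hchar k S) ih
      rw [Matrix.diagonal_mul_diagonal] at this
      simpa [Finset.prod_insert hk] using this
  have hsingle (S : Finset M) : Matrix.single S S (1 : ℂ) ∈ A := by
    have := hdiag S Finset.univ
    convert this using 1
    ext T U
    rw [Matrix.single_apply, Matrix.diagonal_apply]
    by_cases hTU : T = U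
    · subst hTU
      by_cases hST : S = T
      · subst hST; simp
      · rw [if_neg (by simp [hST]), if_pos rfl]
        obtain ⟨k, hk⟩ : ∃ k, ¬ (k ∈ T ↔ k ∈ S) := by
          by_contra h; push Not at h
          exact hST (Finset.ext fun k => (h k).symm)
        rw [Finset.prod_eq_zero (Finset.mem_univ k)]
        simp [hk]
    · rw [if_neg (by rintro ⟨rfl, rfl⟩; exact hTU rfl), if_neg hTU]
  have hmove (S D : Finset M) : Matrix.single (symmDiff S D) S (1 : ℂ) ∈ A := by
    induction D using Finset.induction_on with
    | empty =>
      rw [← Finset.bot_eq_empty, symmDiff_bot]; exact hsingle S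
    | insert k D hk ih =>
      have hD : symmDiff S (insert k D) = symmDiff (symmDiff S D) {k} := by
        rw [symmDiff_assoc]; congr 1
        ext l; by_cases h : l = k <;> simp [Finset.mem_symmDiff, h, hk]
      have hw : majoranaWeight (k, 0) (symmDiff S D) ≠ 0 := by
        unfold majoranaWeight
        refine mul_ne_zero (by simp) (Finset.prod_ne_zero_iff.2 fun l _ h => ?_)
        have := majoranaSign_mul_self (k, (0 : Fin 2)) l
        rw [h] at this; simp at this
      have := A.smul_mem (A.mul_mem (hmaj (k, 0)) ih)
        (majoranaWeight (k, 0) (symmDiff S D))⁻¹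
      convert this using 1
      ext T U
      rw [hD, Matrix.smul_apply, Matrix.single_apply]
      by_cases hU : S = U
      · subst hU
        rw [Matrix.mul_single_apply_same, majorana_apply]
        by_cases hT : T = symmDiff (symmDiff S D) {k}
        · simp [hT, hw]
        · simp [hT, Ne.symm hT]
      · rw [Matrix.mul_single_apply_of_ne _ _ _ _ _ (Ne.symm hU)]; simp [hU]
  rw [eq_top_iff]
  intro X _
  rw [Matrix.matrix_eq_sum_single X]
  refine A.sum_mem fun T _ => A.sum_mem fun S _ => ?_
  have := A.smul_mem (hmove S (symmDiff S T)) (X T S)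
  rw [symmDiff_symmDiff_cancel_left] at this
  simpa [Matrix.smul_single] using this

/-- The product of the Majorana operators in a list. -/
noncomputable def majoranaProd (l : List (MajIdx M)) : Op M := (l.map majorana).prod

@[simp] theorem majoranaProd_nil : majoranaProd ([] : List (MajIdx M)) = 1 := rfl

theorem majoranaProd_cons (a : MajIdx M) (l : List (MajIdx M)) :
    majoranaProd (a :: l) = majorana a * majoranaProd l := by simp [majoranaProd]

theorem majoranaProd_mul_majorana {a : MajIdx M} {l : List (MajIdx M)} (h : a ∉ l) :
    majoranaProd l * majorana a = (-1 : ℂ) ^ l.length • (majorana a * majoranaProd l) := by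
  induction l with
  | nil => simp
  | cons b l ih =>
    simp only [List.mem_cons, not_or] at h
    rw [majoranaProd_cons, mul_assoc, ih h.2, mul_smul_comm, ← mul_assoc,
      majorana_anticomm (Ne.symm h.1), List.length_cons, pow_succ]
    simp [mul_assoc]

theorem majorana_mul_majoranaProd_of_mem {a : MajIdx M} {l : List (MajIdx M)} (h : a ∈ l) :
    ∃ s : ℂ, majorana a * majoranaProd l = s • majoranaProd (l.erase a) := by
  induction l with
  | nil => simp at h
  | cons b l ih =>
    by_cases hab : b = a
    · subst hab
      exact ⟨1, by rw [majoranaProd_cons, ← mul_assoc, majorana_mul_self]; simp⟩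
    · obtain ⟨s, hs⟩ := ih (by simpa [Ne.symm hab] using h)
      refine ⟨-s, ?_⟩
      rw [List.erase_cons_tail (by simpa using hab), majoranaProd_cons, majoranaProd_cons,
        ← mul_assoc, majorana_anticomm (Ne.symm hab), neg_mul, mul_assoc, hs]
      simp

/-- The products of distinct Majorana operators span all operators. -/
theorem span_majoranaProd :
    Submodule.span ℂ (majoranaProd '' {l : List (MajIdx M) | l.Nodup}) = ⊤ := by
  set W := Submodule.span ℂ (majoranaProd '' {l : List (MajIdx M) | l.Nodup})
  -- A further Majorana operator either cancels against an equal factor, up to sign, or lengthens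
  -- the list, so the span is a left ideal containing 1.
  have hmul (a : MajIdx M) (X : Op M) (hX : X ∈ W) : majorana a * X ∈ W := by
    refine Submodule.span_induction (p := fun X _ => majorana a * X ∈ W) ?_ ?_ ?_ ?_ hX
    · rintro _ ⟨l, hl, rfl⟩
      by_cases ha : a ∈ l
      · obtain ⟨s, hs⟩ := majorana_mul_majoranaProd_of_mem ha
        rw [hs]
        exact W.smul_mem _ (Submodule.subset_span ⟨_, List.Nodup.erase _ hl, rfl⟩)
      · rw [← majoranaProd_cons]
        exact Submodule.subset_span ⟨_, List.nodup_cons.2 ⟨ha, hl⟩, rfl⟩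
    · simp
    · intro X Y _ _ hX hY; rw [mul_add]; exact W.add_mem hX hY
    · intro c X _ hX; rw [mul_smul_comm]; exact W.smul_mem _ hX
  have h1 : (1 : Op M) ∈ W := Submodule.subset_span ⟨[], List.nodup_nil, rfl⟩
  have hall (Y : Op M) : ∀ X ∈ W, Y * X ∈ W := by
    have hY : Y ∈ Algebra.adjoin ℂ (Set.range (majorana (M := M))) := by
      rw [adjoin_majorana]; trivial
    refine Algebra.adjoin_induction (p := fun Y _ => ∀ X ∈ W, Y * X ∈ W) ?_ ?_ ?_ ?_ hY
    · rintro _ ⟨a, rfl⟩ X hX; exact hmul a X hX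
    · intro r X hX; rw [← Algebra.smul_def]; exact W.smul_mem _ hX
    · intro A B _ _ hA hB X hX; rw [add_mul]; exact W.add_mem (hA X hX) (hB X hX)
    · intro A B _ _ hA hB X hX; rw [mul_assoc]; exact hA _ (hB X hX)
  rw [eq_top_iff]
  intro X _
  simpa using hall X 1 h1

theorem parity_mul_majoranaProd (l : List (MajIdx M)) :
    parity M * majoranaProd l = (-1 : ℂ) ^ l.length • (majoranaProd l * parity M) := by
  induction l with
  | nil => simp
  | cons a l ih =>
    rw [majoranaProd_cons, ← mul_assoc, parity_mul_majorana, neg_mul, mul_assoc, ih,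
      List.length_cons, pow_succ]
    simp [mul_assoc]

/-- Linear maps agreeing on products of distinct Majorana operators are equal. -/
theorem linearMap_ext_majoranaProd {N : Type*} [AddCommMonoid N] [Module ℂ N]
    {f g : Op M →ₗ[ℂ] N} (h : ∀ l : List (MajIdx M), l.Nodup → f (majoranaProd l) =
      g (majoranaProd l)) : f = g :=
  LinearMap.ext_on span_majoranaProd (by rintro _ ⟨l, hl, rfl⟩; exact h l hl)

end Fock

/-! ## Gaussian states -/

section Gaussian

variable {n : Type} [Fintype n] [DecidableEq n]

-- Tensoring with the identity is a continuous ring homomorphism, hence commutes with the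
-- exponential series.
open scoped Matrix.Norms.Operator in
theorem exp_kronecker_one (A : Matrix n n ℂ) :
    NormedSpace.exp A ⊗ₖ (1 : Matrix n n ℂ) = NormedSpace.exp (A ⊗ₖ (1 : Matrix n n ℂ)) := by
  let f : Matrix n n ℂ →+* Matrix (n × n) (n × n) ℂ :=
    { toFun := fun A => A ⊗ₖ (1 : Matrix n n ℂ)
      map_one' := Matrix.one_kronecker_one
      map_mul' := fun A B => by rw [← Matrix.mul_kronecker_mul, one_mul]
      map_zero' := Matrix.zero_kronecker _
      map_add' := fun A B => Matrix.add_kronecker _ _ _ }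
  have hf : Continuous f := by
    refine continuous_matrix fun i j => ?_
    exact (continuous_id.matrix_elem i.1 j.1).mul continuous_const
  exact NormedSpace.map_exp f hf A

open scoped Matrix.Norms.Operator in
theorem exp_one_kronecker (A : Matrix n n ℂ) :
    (1 : Matrix n n ℂ) ⊗ₖ NormedSpace.exp A = NormedSpace.exp ((1 : Matrix n n ℂ) ⊗ₖ A) := by
  let f : Matrix n n ℂ →+* Matrix (n × n) (n × n) ℂ :=
    { toFun := fun A => (1 : Matrix n n ℂ) ⊗ₖ A
      map_one' := Matrix.one_kronecker_one
      map_mul' := fun A B => by rw [← Matrix.mul_kronecker_mul, one_mul]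
      map_zero' := Matrix.kronecker_zero _
      map_add' := fun A B => Matrix.kronecker_add _ _ _ }
  have hf : Continuous f := by
    refine continuous_matrix fun i j => ?_
    exact continuous_const.mul (continuous_id.matrix_elem i.2 j.2)
  exact NormedSpace.map_exp f hf A

theorem exp_kronecker_exp (A : Matrix n n ℂ) :
    NormedSpace.exp A ⊗ₖ NormedSpace.exp A =
      NormedSpace.exp (A ⊗ₖ (1 : Matrix n n ℂ) + (1 : Matrix n n ℂ) ⊗ₖ A) := by
  rw [Matrix.exp_add_of_commute, ← exp_kronecker_one, ← exp_one_kronecker,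
    ← Matrix.mul_kronecker_mul, mul_one, one_mul]
  rw [Commute, SemiconjBy, ← Matrix.mul_kronecker_mul, ← Matrix.mul_kronecker_mul]
  simp

omit [Fintype n] [DecidableEq n] in
theorem sum_kronecker {κ : Type} (s : Finset κ) (f : κ → Matrix n n ℂ) (B : Matrix n n ℂ) :
    (∑ k ∈ s, f k) ⊗ₖ B = ∑ k ∈ s, f k ⊗ₖ B := by
  ext i j; simp [Matrix.sum_apply, Finset.sum_mul]

omit [Fintype n] [DecidableEq n] in
theorem kronecker_sum {κ : Type} (s : Finset κ) (A : Matrix n n ℂ) (f : κ → Matrix n n ℂ) :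
    A ⊗ₖ (∑ k ∈ s, f k) = ∑ k ∈ s, A ⊗ₖ f k := by
  ext i j; simp [Matrix.sum_apply, Finset.mul_sum]

/-! ### Anticommutation relations, the invariant Λ and Wick's recursion. -/

variable {ι : Type} [DecidableEq ι]

/-- The anticommutation relations of Majorana operators. -/
def IsCAR (c : ι → Matrix n n ℂ) : Prop :=
  ∀ a b, c a * c b + c b * c a = if a = b then 2 else 0

theorem IsCAR.eq_sub {c : ι → Matrix n n ℂ} (hc : IsCAR c) (a b : ι) :
    c a * c b = (if a = b then (2 : ℂ) else 0) • (1 : Matrix n n ℂ) - c b * c a := by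
  rw [eq_sub_iff_add_eq, hc a b]
  split_ifs
  · rw [two_smul, one_add_one_eq_two]
  · simp

/-- Commutator of a quadratic monomial with a Majorana operator. -/
theorem IsCAR.quad_commutator {c : ι → Matrix n n ℂ} (hc : IsCAR c) (k l a : ι) :
    c k * c l * c a = c a * (c k * c l) +
      ((if l = a then (2 : ℂ) else 0) • c k - (if k = a then (2 : ℂ) else 0) • c l) := by
  rw [mul_assoc, hc.eq_sub l a, mul_sub, ← mul_assoc, hc.eq_sub k a, sub_mul, mul_assoc]
  simp only [mul_smul_comm, mul_one, smul_mul_assoc, one_mul]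
  abel

variable [Fintype ι]

/-- Commutation with a quadratic H acts on the span of the `c a` by an antisymmetric matrix, so H ⊗
1 + 1 ⊗ H annihilates the invariant bilinear tensor Λ; exponentiating gives the claim. -/
theorem commute_lambda_exp {c : ι → Matrix n n ℂ} (hc : IsCAR c) (h : ι → ι → ℂ)
    (hh : ∀ k l, h k l = -h l k) :
    Commute (∑ a, c a ⊗ₖ c a)
      (NormedSpace.exp (∑ k, ∑ l, h k l • (c k * c l)) ⊗ₖ
        NormedSpace.exp (∑ k, ∑ l, h k l • (c k * c l))) := by
  rw [exp_kronecker_exp]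
  refine Commute.exp_right ?_
  set H := ∑ k, ∑ l, h k l • (c k * c l) with hH
  have hcomm (a : ι) : H * c a = c a * H + ∑ k, (4 * h k a) • c k := by
    have e1 : H * c a = c a * H + ∑ k, ∑ l, h k l •
        ((if l = a then (2 : ℂ) else 0) • c k - (if k = a then (2 : ℂ) else 0) • c l) := by
      simp only [hH, Finset.sum_mul, Finset.mul_sum, ← Finset.sum_add_distrib, smul_mul_assoc,
        mul_smul_comm, hc.quad_commutator _ _ a, smul_add]
    rw [e1]
    congr 1
    have e2 : ∑ k, ∑ l, h k l • ((if l = a then (2 : ℂ) else 0) • c k) =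
        ∑ k, (2 * h k a) • c k := by
      refine Finset.sum_congr rfl fun k _ => ?_
      rw [Finset.sum_eq_single a]
      · rw [if_pos rfl, smul_smul, mul_comm]
      · intro l _ hl; simp [hl]
      · simp
    have e3 : ∑ k, ∑ l, h k l • ((if k = a then (2 : ℂ) else 0) • c l) =
        -∑ k, (2 * h k a) • c k := by
      rw [Finset.sum_eq_single a]
      · rw [← Finset.sum_neg_distrib]
        refine Finset.sum_congr rfl fun l _ => ?_
        rw [if_pos rfl, smul_smul, hh a l, ← neg_smul]; congr 1; ring
      · intro l _ hl; simp [hl]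
      · simp
    simp only [smul_sub, Finset.sum_sub_distrib]
    rw [e2, e3, sub_neg_eq_add, ← Finset.sum_add_distrib]
    refine Finset.sum_congr rfl fun k _ => ?_
    rw [← add_smul]; congr 1; ring
  -- Invariance of Λ: the two sums cancel because `h` is antisymmetric.
  have hR : (∑ a, ∑ k, (4 * h k a) • (c k ⊗ₖ c a)) + ∑ a, ∑ k, (4 * h k a) • (c a ⊗ₖ c k) = 0 := by
    rw [Finset.sum_comm (f := fun a k => (4 * h k a) • (c k ⊗ₖ c a)), ← Finset.sum_add_distrib]
    refine Finset.sum_eq_zero fun a _ => ?_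
    rw [← Finset.sum_add_distrib]
    refine Finset.sum_eq_zero fun k _ => ?_
    rw [← add_smul, hh a k]; ring_nf; simp
  symm
  rw [Commute, SemiconjBy, ← sub_eq_zero, ← hR]
  simp only [Finset.mul_sum, Finset.sum_mul, add_mul, mul_add, ← Matrix.mul_kronecker_mul,
    one_mul, mul_one, hcomm, Matrix.add_kronecker, Matrix.kronecker_add,
    Finset.sum_add_distrib]
  simp only [sum_kronecker, kronecker_sum, Matrix.smul_kronecker, Matrix.kronecker_smul]
  abel

/-- Properties of Gaussian states that pass to limits. -/
structure GaussianProperties (c : ι → Matrix n n ℂ) (ρ : Matrix n n ℂ) : Prop where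
  trace_eq_one : ρ.trace = 1
  isHermitian : ρᴴ = ρ
  commute_of_anticommute : ∀ g : Matrix n n ℂ, (∀ a, g * c a = -(c a * g)) → g * ρ = ρ * g
  commute_lambda : Commute (∑ a, c a ⊗ₖ c a) (ρ ⊗ₖ ρ)

/-- All four properties are closed conditions, so it suffices to check them on exponentials.
Hermiticity holds because the adjoint reverses `c k * c l` and conjugates the factor i, and the
antisymmetry of G makes up for both. -/
theorem IsGaussianState.gaussianProperties {c : ι → Matrix n n ℂ} (hc : IsCAR c)
    (hherm : ∀ a, (c a)ᴴ = c a) {ρ : Matrix n n ℂ} (hρ : IsGaussianState c ρ) :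
    GaussianProperties c ρ := by
  have hclosed : IsClosed {ρ : Matrix n n ℂ | ρ.trace = 1 ∧ ρᴴ = ρ ∧
      (∀ g : Matrix n n ℂ, (∀ a, g * c a = -(c a * g)) → g * ρ = ρ * g) ∧
      (∑ a, c a ⊗ₖ c a) * (ρ ⊗ₖ ρ) = (ρ ⊗ₖ ρ) * (∑ a, c a ⊗ₖ c a)} := by
    have hk : Continuous fun ρ : Matrix n n ℂ => ρ ⊗ₖ ρ := by
      refine continuous_matrix fun i j => ?_
      exact (continuous_id.matrix_elem i.1 j.1).mul (continuous_id.matrix_elem i.2 j.2)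
    have hcomm : IsClosed {ρ : Matrix n n ℂ |
        ∀ g : Matrix n n ℂ, (∀ a, g * c a = -(c a * g)) → g * ρ = ρ * g} := by
      simp only [Set.ofPred_forall]
      exact isClosed_iInter fun g => isClosed_iInter fun _ =>
        isClosed_eq (continuous_const.matrix_mul continuous_id)
          (continuous_id.matrix_mul continuous_const)
    exact (isClosed_eq continuous_id.matrix_trace continuous_const).inter
      ((isClosed_eq continuous_id.matrix_conjTranspose continuous_id).inter (hcomm.inter
        (isClosed_eq (continuous_const.matrix_mul hk) (hk.matrix_mul continuous_const))))
  have hmem := hclosed.closure_subset_iff.2 ?_ hρ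
  · exact ⟨hmem.1, hmem.2.1, hmem.2.2.1, hmem.2.2.2⟩
  rintro σ ⟨G, K, hG, htr, hσ⟩
  have hG' (k l : ι) : G k l = -G l k := by
    have := congrFun (congrFun hG l) k
    simpa using this
  have hsum : (-(Complex.I / 4)) • ∑ k, ∑ l, (G k l : ℂ) • (c k * c l) =
      ∑ k, ∑ l, (-(Complex.I / 4) * (G k l : ℂ)) • (c k * c l) := by
    simp only [Finset.smul_sum, smul_smul]
  refine ⟨htr, ?_, ?_, ?_⟩
  · rw [hσ, Matrix.conjTranspose_smul, ← Matrix.exp_conjTranspose, hsum]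
    congr 1
    · simp
    · congr 1
      simp only [Matrix.conjTranspose_sum, Matrix.conjTranspose_smul, Matrix.conjTranspose_mul,
        hherm]
      rw [Finset.sum_comm]
      refine Finset.sum_congr rfl fun k _ => Finset.sum_congr rfl fun l _ => ?_
      rw [hG' k l]
      congr 1
      simp [neg_div]
  · intro g hg
    rw [hσ, mul_smul_comm, smul_mul_assoc]
    congr 1
    refine Commute.exp_right ?_
    rw [hsum]
    refine Commute.sum_right _ _ _ fun k _ => Commute.sum_right _ _ _ fun l _ => ?_
    refine Commute.smul_right ?_ _
    rw [Commute, SemiconjBy, ← mul_assoc, hg, neg_mul, mul_assoc, hg]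
    simp [mul_assoc]
  · have := commute_lambda_exp hc (fun k l => -(Complex.I / 4) * (G k l : ℂ)) (fun k l => by
      rw [hG' k l]; push_cast; ring)
    rw [hσ, hsum]
    rw [Matrix.smul_kronecker, Matrix.kronecker_smul]
    exact (this.smul_right _).smul_right _

/-- The recursion behind Wick's theorem. -/
theorem GaussianProperties.wick {c : ι → Matrix n n ℂ} (hc : IsCAR c) {ρ : Matrix n n ℂ}
    (hρ : GaussianProperties c ρ) (b : ι) (X : Matrix n n ℂ) :
    2 * (ρ * (c b * X)).trace =
      ∑ k, (ρ * (c b * c k)).trace * (ρ * (X * c k + c k * X)).trace := by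
  -- Tracing against X ⊗ c_b factorises both sides into products of traces. On the right tr(ρ c_k
  -- c_b) = 2δ_kb − tr(ρ c_b c_k), and the δ isolates tr(ρ c_b X).
  have h1 := congrArg (fun Y => (Y * (X ⊗ₖ c b)).trace) hρ.commute_lambda.eq
  simp only [Finset.sum_mul, Finset.mul_sum, ← Matrix.mul_kronecker_mul, Matrix.trace_sum,
    Matrix.trace_kronecker] at h1
  have h2 (k : ι) : (c k * ρ * c b).trace = (ρ * (c b * c k)).trace := by
    rw [mul_assoc, Matrix.trace_mul_comm, mul_assoc]
  have h3 (k : ι) : (ρ * c k * c b).trace =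
      (if k = b then 2 else 0) - (ρ * (c b * c k)).trace := by
    rw [mul_assoc, hc.eq_sub k b, mul_sub, Matrix.trace_sub, mul_smul_comm, mul_one,
      Matrix.trace_smul, hρ.trace_eq_one, smul_eq_mul, mul_one]
  have h4 (k : ι) : (c k * ρ * X).trace = (ρ * (X * c k)).trace := by
    rw [mul_assoc, Matrix.trace_mul_comm, mul_assoc]
  simp only [h2, h3, h4] at h1
  have h5 : ∑ k, (ρ * c k * X).trace * (if k = b then (2 : ℂ) else 0) =
      2 * (ρ * (c b * X)).trace := by
    rw [Finset.sum_eq_single b]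
    · rw [if_pos rfl, mul_comm, mul_assoc]
    · intro k _ hk; simp [hk]
    · simp
  simp only [mul_sub, Finset.sum_sub_distrib] at h1
  rw [h5] at h1
  have h6 : ∑ k, (ρ * (c b * c k)).trace * (ρ * (X * c k + c k * X)).trace =
      ∑ k, (ρ * (X * c k)).trace * (ρ * (c b * c k)).trace +
      ∑ k, (ρ * c k * X).trace * (ρ * (c b * c k)).trace := by
    rw [← Finset.sum_add_distrib]
    refine Finset.sum_congr rfl fun k _ => ?_
    rw [mul_add, Matrix.trace_add, mul_assoc ρ (c k) X]; ring
  rw [h6, h1]; ring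

end Gaussian

/-! ## The Choi–Jamiołkowski state and the dual map -/

section Doubled

variable {M : Type} [LinearOrder M] [Fintype M]

theorem doubledMajorana_isCAR : IsCAR (doubledMajorana (M := M)) := by
  have hcar (a b : MajIdx M) := majorana_mul_add a b
  rintro (a | a) (b | b)
  · simp only [doubledMajorana, ← Matrix.mul_kronecker_mul, mul_one, ← Matrix.add_kronecker, hcar,
      Sum.inl.injEq]
    split_ifs
    · rw [← one_add_one_eq_two, Matrix.add_kronecker, Matrix.one_kronecker_one, one_add_one_eq_two]
    · simp
  · simp only [doubledMajorana, ← Matrix.mul_kronecker_mul, mul_one, one_mul, parity_mul_majorana,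
      ← Matrix.add_kronecker]
    simp
  · simp only [doubledMajorana, ← Matrix.mul_kronecker_mul, mul_one, one_mul, parity_mul_majorana,
      ← Matrix.add_kronecker]
    simp
  · simp only [doubledMajorana, ← Matrix.mul_kronecker_mul, parity_mul_self,
      ← Matrix.kronecker_add, hcar, Sum.inr.injEq]
    split_ifs
    · rw [← one_add_one_eq_two, Matrix.kronecker_add, Matrix.one_kronecker_one, one_add_one_eq_two]
    · simp

omit [Fintype M] in
theorem doubledMajorana_conjTranspose (k : MajIdx M ⊕ MajIdx M) :
    (doubledMajorana k)ᴴ = doubledMajorana k := by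
  rcases k with a | a <;>
    simp [doubledMajorana, Matrix.conjTranspose_kronecker, majorana_conjTranspose,
      parity_conjTranspose]

/-- This makes P ⊗ P an admissible `g` in `commute_of_anticommute`, so that a Gaussian CJ state is
even. -/
theorem parity_kronecker_mul_doubledMajorana (k : MajIdx M ⊕ MajIdx M) :
    (parity M ⊗ₖ parity M) * doubledMajorana k = -(doubledMajorana k * (parity M ⊗ₖ parity M)) := by
  have hneg (A B : Op M) : A ⊗ₖ (-B) = -(A ⊗ₖ B) := by ext; simp
  have hneg' (A B : Op M) : (-A) ⊗ₖ B = -(A ⊗ₖ B) := by ext; simp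
  rcases k with a | a <;>
    simp [doubledMajorana, ← Matrix.mul_kronecker_mul, parity_mul_majorana, hneg, hneg']

/-- The operator `i c_a c'_a`, which stabilises the maximally entangled state. -/
noncomputable def stabilizer (a : MajIdx M) :
    Matrix (Finset M × Finset M) (Finset M × Finset M) ℂ :=
  (Complex.I • (majorana a * parity M)) ⊗ₖ majorana a

theorem stabilizer_eq (a : MajIdx M) : Complex.I •
    (doubledMajorana (Sum.inl a) * doubledMajorana (Sum.inr a)) = stabilizer a := by
  simp [doubledMajorana, stabilizer, ← Matrix.mul_kronecker_mul, Matrix.smul_kronecker]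

theorem majorana_parity_mul (a b : MajIdx M) :
    majorana a * parity M * (majorana b * parity M) = -(majorana a * majorana b) := by
  rw [mul_assoc, ← mul_assoc (parity M), parity_mul_majorana, neg_mul, mul_assoc, parity_mul_self]
  simp

theorem stabilizer_mul_self (a : MajIdx M) : stabilizer a * stabilizer a = 1 := by
  rw [stabilizer, ← Matrix.mul_kronecker_mul, majorana_mul_self, smul_mul_smul_comm,
    majorana_parity_mul, majorana_mul_self]
  simp

/-- For different indices both tensor factors anticommute, and the two signs cancel. -/
theorem stabilizer_commute (a b : MajIdx M) : Commute (stabilizer a) (stabilizer b) := by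
  by_cases hab : a = b
  · rw [hab]
  have hneg (A B : Op M) : (-A) ⊗ₖ (-B) = (A ⊗ₖ B) := by ext; simp
  rw [Commute, SemiconjBy, stabilizer, stabilizer, ← Matrix.mul_kronecker_mul,
    ← Matrix.mul_kronecker_mul, smul_mul_smul_comm, smul_mul_smul_comm, majorana_parity_mul,
    majorana_parity_mul, majorana_anticomm hab, ← hneg]
  simp

theorem stabilizer_conjTranspose (a : MajIdx M) : (stabilizer a)ᴴ = stabilizer a := by
  rw [stabilizer, Matrix.conjTranspose_kronecker, Matrix.conjTranspose_smul,
    Matrix.conjTranspose_mul, majorana_conjTranspose, parity_conjTranspose, parity_mul_majorana]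
  simp

theorem maxEntangled_eq : maxEntangled M =
    ((Finset.univ : Finset (MajIdx M)).toList.map fun a =>
      (1 / 2 : ℂ) • (1 + stabilizer a)).prod := by
  simp only [maxEntangled, stabilizer_eq]

theorem commute_maxEntangled {X : Matrix (Finset M × Finset M) (Finset M × Finset M) ℂ}
    (hX : ∀ a, Commute X (stabilizer a)) : Commute X (maxEntangled M) := by
  rw [maxEntangled_eq]
  refine Commute.list_prod_right _ _ fun Y hY => ?_
  obtain ⟨a, -, rfl⟩ := List.mem_map.1 hY
  exact ((Commute.one_right X).add_right (hX a)).smul_right _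

/-- The state is a product of commuting factors (1 + S_a)/2 with S_a² = 1, and S_a(1 + S_a) = 1 +
S_a. -/
theorem stabilizer_mul_maxEntangled (a : MajIdx M) :
    stabilizer a * maxEntangled M = maxEntangled M := by
  have hmem : a ∈ (Finset.univ : Finset (MajIdx M)).toList := by simp
  obtain ⟨l₁, l₂, hl⟩ := List.append_of_mem hmem
  have h1 : Commute (stabilizer a) ((l₁.map fun a =>
      (1 / 2 : ℂ) • (1 + stabilizer a)).prod) := by
    refine Commute.list_prod_right _ _ fun Y hY => ?_
    obtain ⟨b, -, rfl⟩ := List.mem_map.1 hY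
    exact ((Commute.one_right _).add_right (stabilizer_commute a b)).smul_right _
  rw [maxEntangled_eq, hl, List.map_append, List.prod_append, List.map_cons, List.prod_cons,
    ← mul_assoc, h1.eq, mul_assoc, ← mul_assoc (stabilizer a), mul_smul_comm, mul_add,
    stabilizer_mul_self, mul_one, add_comm (stabilizer a)]

theorem maxEntangled_mul_stabilizer (a : MajIdx M) :
    maxEntangled M * stabilizer a = maxEntangled M := by
  rw [← (commute_maxEntangled (stabilizer_commute a)).eq, stabilizer_mul_maxEntangled]

theorem maxEntangled_conjTranspose : (maxEntangled M)ᴴ = maxEntangled M := by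
  rw [maxEntangled_eq, Matrix.conjTranspose_list_prod, List.map_map, ← List.map_reverse]
  have : (Matrix.conjTranspose ∘ fun a : MajIdx M => (1 / 2 : ℂ) • (1 + stabilizer a)) =
      fun a => (1 / 2 : ℂ) • (1 + stabilizer a) := by
    funext a
    simp [stabilizer_conjTranspose]
  rw [this]
  refine List.Perm.prod_eq' ((List.reverse_perm _).map _) ?_
  refine List.pairwise_of_forall_mem_list fun X hX Y hY => ?_
  obtain ⟨a, -, rfl⟩ := List.mem_map.1 hX
  obtain ⟨b, -, rfl⟩ := List.mem_map.1 hY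
  exact ((((Commute.one_right _).add_right ((Commute.one_left _).add_left
    (stabilizer_commute a b))).smul_right _).smul_left _)

/-- The fermionic transpose trick: insert the stabilizer and cancel the square of the ancilla
factor. The parity appears because the ancilla operator here is 1 ⊗ c_a, without the Jordan–Wigner
string P. -/
theorem ancilla_mul_maxEntangled (a : MajIdx M) :
    ((1 : Op M) ⊗ₖ majorana a) * maxEntangled M =
      Complex.I • (((majorana a * parity M) ⊗ₖ (1 : Op M)) * maxEntangled M) := by
  nth_rw 1 [← stabilizer_mul_maxEntangled a]
  rw [← mul_assoc, stabilizer, ← Matrix.mul_kronecker_mul, one_mul, majorana_mul_self,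
    Matrix.smul_kronecker, smul_mul_assoc]

theorem maxEntangled_mul_ancilla (a : MajIdx M) :
    maxEntangled M * ((1 : Op M) ⊗ₖ majorana a) =
      Complex.I • (maxEntangled M * ((majorana a * parity M) ⊗ₖ (1 : Op M))) := by
  nth_rw 1 [← maxEntangled_mul_stabilizer a]
  rw [mul_assoc, stabilizer, ← Matrix.mul_kronecker_mul, mul_one, majorana_mul_self,
    Matrix.smul_kronecker, mul_smul_comm]

/-- The system operators whose action on a state can be moved to the ancilla. -/
noncomputable def transferable (Ω : Matrix (Finset M × Finset M) (Finset M × Finset M) ℂ) :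
    Subalgebra ℂ (Op M) where
  carrier := {Y | ∃ Y' : Op M, (Y ⊗ₖ (1 : Op M)) * Ω = ((1 : Op M) ⊗ₖ Y') * Ω}
  mul_mem' := by
    rintro A B ⟨A', hA⟩ ⟨B', hB⟩
    -- Transfer reverses products: `B` is adjacent to the state and moves first, and `A` then passes
    -- `B'` because they act on different factors.
    refine ⟨B' * A', ?_⟩
    have h1 : (A * B) ⊗ₖ (1 : Op M) = (A ⊗ₖ (1 : Op M)) * (B ⊗ₖ (1 : Op M)) := by
      rw [← Matrix.mul_kronecker_mul, one_mul]
    have h2 : (1 : Op M) ⊗ₖ (B' * A') = ((1 : Op M) ⊗ₖ B') * ((1 : Op M) ⊗ₖ A') := by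
      rw [← Matrix.mul_kronecker_mul, one_mul]
    rw [h1, h2, mul_assoc, hB, mul_assoc, ← hA, ← mul_assoc, ← mul_assoc,
      ← Matrix.mul_kronecker_mul, ← Matrix.mul_kronecker_mul]
    simp
  add_mem' := by
    rintro A B ⟨A', hA⟩ ⟨B', hB⟩
    exact ⟨A' + B', by rw [Matrix.add_kronecker, Matrix.kronecker_add, add_mul, add_mul, hA, hB]⟩
  algebraMap_mem' := fun r => ⟨r • 1, by
    rw [Algebra.algebraMap_eq_smul_one, Matrix.smul_kronecker, Matrix.kronecker_smul]⟩

/-- The products c_a P transfer directly. Quadratic monomials therefore transfer too, hence so does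
P, being generated by them, and finally each c_a = (c_a P)P. These generate all operators. -/
theorem exists_transfer (Y : Op M) : ∃ Y' : Op M,
    (Y ⊗ₖ (1 : Op M)) * maxEntangled M = ((1 : Op M) ⊗ₖ Y') * maxEntangled M := by
  have hP : parity M ∈ transferable (maxEntangled M) := by
    refine parity_mem _ fun k => ⟨majorana (k, 1) * majorana (k, 0), ?_⟩
    set a : MajIdx M := (k, 0)
    set b : MajIdx M := (k, 1)
    have h2 : (1 : Op M) ⊗ₖ (majorana b * majorana a) =
        ((1 : Op M) ⊗ₖ majorana b) * ((1 : Op M) ⊗ₖ majorana a) := by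
      rw [← Matrix.mul_kronecker_mul, one_mul]
    have h3 : ((1 : Op M) ⊗ₖ majorana b) * ((majorana a * parity M) ⊗ₖ (1 : Op M)) =
        ((majorana a * parity M) ⊗ₖ (1 : Op M)) * ((1 : Op M) ⊗ₖ majorana b) := by
      simp [← Matrix.mul_kronecker_mul]
    rw [h2, mul_assoc, ancilla_mul_maxEntangled, mul_smul_comm, ← mul_assoc, h3, mul_assoc,
      ancilla_mul_maxEntangled, mul_smul_comm, smul_smul, Complex.I_mul_I, ← mul_assoc,
      ← Matrix.mul_kronecker_mul, majorana_parity_mul, mul_one]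
    have hneg : (-(majorana a * majorana b)) ⊗ₖ (1 : Op M) =
        -((majorana a * majorana b) ⊗ₖ (1 : Op M)) := by ext; simp
    rw [hneg, neg_mul, neg_one_smul, neg_neg]
  have hmem (a : MajIdx M) : majorana a ∈ transferable (maxEntangled M) := by
    have h1 : majorana a * parity M ∈ transferable (maxEntangled M) :=
      ⟨-Complex.I • majorana a, by
        rw [Matrix.kronecker_smul, smul_mul_assoc, ancilla_mul_maxEntangled, smul_smul]
        simp⟩
    have := (transferable (maxEntangled M)).mul_mem h1 hP
    rwa [mul_assoc, parity_mul_self, mul_one] at this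
  have : Algebra.adjoin ℂ (Set.range (majorana (M := M))) ≤ transferable (maxEntangled M) :=
    Algebra.adjoin_le (by rintro _ ⟨a, rfl⟩; exact hmem a)
  rw [adjoin_majorana] at this
  exact this (show Y ∈ (⊤ : Subalgebra ℂ (Op M)) from trivial)

theorem exists_transfer_right (Y : Op M) : ∃ Y' : Op M,
    maxEntangled M * (Y ⊗ₖ (1 : Op M)) = maxEntangled M * ((1 : Op M) ⊗ₖ Y') := by
  obtain ⟨Y', hY'⟩ := exists_transfer Yᴴ
  refine ⟨Y'ᴴ, ?_⟩
  have := congrArg Matrix.conjTranspose hY'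
  simpa [Matrix.conjTranspose_mul, Matrix.conjTranspose_kronecker, maxEntangled_conjTranspose]
    using this

/-- The linear form `X ↦ tr (|Φ⁺⟩⟨Φ⁺| (X ⊗ W))`. -/
noncomputable def pairing (W : Op M) : Op M →ₗ[ℂ] ℂ where
  toFun X := (maxEntangled M * (X ⊗ₖ W)).trace
  map_add' X Y := by rw [Matrix.add_kronecker, mul_add, Matrix.trace_add]
  map_smul' r X := by rw [Matrix.smul_kronecker, mul_smul_comm, Matrix.trace_smul]; rfl

theorem pairing_apply (W X : Op M) : pairing W X = (maxEntangled M * (X ⊗ₖ W)).trace := rfl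

/-- By transfer the radical of the pairing is a two-sided ideal of a full matrix algebra. Were it
nonzero it would contain 1, contradicting tr |Φ⁺⟩⟨Φ⁺| = 1. -/
theorem eq_of_pairing_eq (h1 : (maxEntangled M).trace = 1) {X Y : Op M}
    (h : ∀ W, pairing W X = pairing W Y) : X = Y := by
  rw [← sub_eq_zero]
  set Z := X - Y
  have hZ (W : Op M) : pairing W Z = 0 := by simp [Z, h W]
  have hr (A B W : Op M) (hA : ∀ W, pairing W A = 0) : pairing W (A * B) = 0 := by
    obtain ⟨B', hB⟩ := exists_transfer B
    have e : (A * B) ⊗ₖ W = (A ⊗ₖ W) * (B ⊗ₖ (1 : Op M)) := by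
      rw [← Matrix.mul_kronecker_mul, mul_one]
    rw [pairing_apply, e, ← mul_assoc, Matrix.trace_mul_comm, ← mul_assoc, hB, mul_assoc,
      Matrix.trace_mul_comm, mul_assoc, ← Matrix.mul_kronecker_mul, mul_one]
    exact hA _
  have hl (A B W : Op M) (hA : ∀ W, pairing W A = 0) : pairing W (B * A) = 0 := by
    obtain ⟨B', hB⟩ := exists_transfer_right B
    have e : (B * A) ⊗ₖ W = (B ⊗ₖ (1 : Op M)) * (A ⊗ₖ W) := by
      rw [← Matrix.mul_kronecker_mul, one_mul]
    rw [pairing_apply, e, ← mul_assoc, hB, mul_assoc, ← Matrix.mul_kronecker_mul, one_mul]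
    exact hA _
  ext S T
  -- Matrix units turn a single entry of `Z` into a multiple of the identity while staying in the
  -- ideal.
  have e : ∑ U, Matrix.single U S (1 : ℂ) * Z * Matrix.single T U 1 = Z S T • (1 : Op M) := by
    ext V W
    simp only [Matrix.sum_apply, Matrix.single_mul_mul_single, one_mul, mul_one,
      Matrix.single_apply, Matrix.smul_apply, Matrix.one_apply, smul_eq_mul, mul_ite, mul_zero]
    by_cases hVW : V = W
    · subst hVW; simp
    · rw [if_neg hVW]
      exact Finset.sum_eq_zero fun U _ => if_neg (by rintro ⟨rfl, rfl⟩; exact hVW rfl)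
  have h0 : pairing 1 (Z S T • (1 : Op M)) = 0 := by
    rw [← e, map_sum]
    exact Finset.sum_eq_zero fun U _ => hr _ _ _ fun W => hl _ _ _ hZ
  rw [map_smul, pairing_apply, Matrix.one_kronecker_one, mul_one, h1] at h0
  simpa using h0

theorem pairing_mul_majorana (W X : Op M) (a : MajIdx M) :
    pairing (W * majorana a) X = Complex.I * pairing W (X * (majorana a * parity M)) := by
  have e : X ⊗ₖ (W * majorana a) = (X ⊗ₖ W) * ((1 : Op M) ⊗ₖ majorana a) := by
    rw [← Matrix.mul_kronecker_mul, mul_one]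
  rw [pairing_apply, e, ← mul_assoc, Matrix.trace_mul_comm, ← mul_assoc, ancilla_mul_maxEntangled,
    smul_mul_assoc, Matrix.trace_smul, mul_assoc, Matrix.trace_mul_comm, mul_assoc,
    ← Matrix.mul_kronecker_mul, mul_one]
  rfl

theorem pairing_majorana_mul (W X : Op M) (a : MajIdx M) :
    pairing (majorana a * W) X = Complex.I * pairing W (majorana a * parity M * X) := by
  have e : X ⊗ₖ (majorana a * W) = ((1 : Op M) ⊗ₖ majorana a) * (X ⊗ₖ W) := by
    rw [← Matrix.mul_kronecker_mul, one_mul]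
  rw [pairing_apply, e, ← mul_assoc, maxEntangled_mul_ancilla,
    smul_mul_assoc, Matrix.trace_smul, mul_assoc,
    ← Matrix.mul_kronecker_mul, one_mul]
  rfl

theorem pairing_conj_parity (W X : Op M) :
    pairing W (parity M * X * parity M) = pairing (parity M * W * parity M) X := by
  have hg : Commute (parity M ⊗ₖ parity M) (maxEntangled M) := by
    refine commute_maxEntangled fun a => ?_
    rw [← stabilizer_eq]
    refine Commute.smul_right ?_ _
    rw [Commute, SemiconjBy, ← mul_assoc, parity_kronecker_mul_doubledMajorana, neg_mul, mul_assoc,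
      parity_kronecker_mul_doubledMajorana]
    simp [mul_assoc]
  have e : (parity M * X * parity M) ⊗ₖ W =
      (parity M ⊗ₖ parity M) * (X ⊗ₖ (parity M * W * parity M)) * (parity M ⊗ₖ parity M) := by
    simp only [← Matrix.mul_kronecker_mul]
    congr 1
    rw [← mul_assoc, ← mul_assoc, parity_mul_self, one_mul, mul_assoc, parity_mul_self, mul_one]
  rw [pairing_apply, pairing_apply, e, ← mul_assoc, ← mul_assoc, Matrix.trace_mul_comm,
    ← mul_assoc, ← mul_assoc, hg.eq, mul_assoc (maxEntangled M), ← Matrix.mul_kronecker_mul,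
    parity_mul_self, Matrix.one_kronecker_one, mul_one]

/-! ### The Heisenberg-picture dual and its relation to the CJ state. -/

/-- The Heisenberg-picture map, defined by `tr (F(Z) X) = tr (Z E(X))`. -/
noncomputable def dualMap (E : SuperOp M) : SuperOp M where
  toFun Z := Matrix.of fun T S => (Z * E (Matrix.single S T 1)).trace
  map_add' Z Y := by ext; simp [add_mul]
  map_smul' r Z := by ext; simp

theorem trace_dualMap_mul (E : SuperOp M) (Z X : Op M) :
    (dualMap E Z * X).trace = (Z * E X).trace := by
  conv_rhs => rw [Matrix.matrix_eq_sum_single X]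
  simp only [map_sum, Finset.mul_sum, Matrix.trace_sum]
  rw [Matrix.trace, Finset.sum_comm]
  refine Finset.sum_congr rfl fun T _ => ?_
  rw [Matrix.diag_apply, Matrix.mul_apply]
  refine Finset.sum_congr rfl fun S _ => ?_
  have : Matrix.single S T (X S T) = X S T • Matrix.single S T (1 : ℂ) := by
    simp [Matrix.smul_single]
  rw [this, map_smul, mul_smul_comm, Matrix.trace_smul, smul_eq_mul, mul_comm]
  rfl

theorem trace_ampliation_mul {R : Type} [Fintype R] (E : SuperOp M)
    (X : Matrix (Finset M × R) (Finset M × R) ℂ) (Z : Op M) (W : Matrix R R ℂ) :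
    (ampliation E X * (Z ⊗ₖ W)).trace = (X * (dualMap E Z ⊗ₖ W)).trace := by
  -- Expanding over the ancilla indices leaves ordinary system traces of the blocks `G r s`, to
  -- which the defining duality applies blockwise.
  have key (E : SuperOp M) (Z' : Op M) (X' : Matrix (Finset M × R) (Finset M × R) ℂ)
      (G : R → R → Op M) (hG : ∀ r s S T, X' (S, r) (T, s) = G r s S T) :
      (X' * (Z' ⊗ₖ W)).trace = ∑ r, ∑ s, W s r * (Z' * G r s).trace := by
    simp only [Matrix.trace, Matrix.diag_apply, Matrix.mul_apply, Fintype.sum_prod_type,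
      Matrix.kronecker_apply, hG, Finset.mul_sum]
    rw [Finset.sum_comm]
    refine Finset.sum_congr rfl fun r _ => ?_
    rw [Finset.sum_congr rfl fun S _ => Finset.sum_comm, Finset.sum_comm]
    refine Finset.sum_congr rfl fun s _ => ?_
    rw [Finset.sum_comm]
    refine Finset.sum_congr rfl fun S _ => Finset.sum_congr rfl fun T _ => ?_
    ring
  rw [key E Z _ (fun r s => E (Matrix.of fun S T => X (S, r) (T, s))) (fun _ _ _ _ => rfl),
    key E (dualMap E Z) X (fun r s => Matrix.of fun S T => X (S, r) (T, s))
      (fun _ _ _ _ => rfl)]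
  simp only [trace_dualMap_mul]

theorem trace_cjState_mul (E : SuperOp M) (Z W : Op M) :
    (cjState E * (Z ⊗ₖ W)).trace = pairing W (dualMap E Z) :=
  trace_ampliation_mul E _ Z W

theorem dualMap_one {E : SuperOp M} (hE : ∀ X : Op M, (E X).trace = X.trace) :
    dualMap E 1 = 1 := by
  ext T S
  change (1 * E (Matrix.single S T 1)).trace = _
  rw [one_mul, hE, Matrix.one_apply]
  by_cases h : S = T
  · subst h; simp
  · rw [Matrix.trace_single_eq_of_ne _ _ _ h, if_neg (Ne.symm h)]

/-- The dual map twisted by the parity on both sides. -/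
noncomputable def twistedDualMap (E : SuperOp M) : SuperOp M :=
  (LinearMap.mulRight ℂ (parity M)) ∘ₗ dualMap E ∘ₗ (LinearMap.mulRight ℂ (parity M))

theorem twistedDualMap_apply (E : SuperOp M) (Z : Op M) :
    twistedDualMap E Z = dualMap E (Z * parity M) * parity M := rfl

theorem twistedDualMap_mul_parity (E : SuperOp M) (Z : Op M) :
    twistedDualMap E (Z * parity M) = dualMap E Z * parity M := by
  rw [twistedDualMap_apply, mul_assoc, parity_mul_self, mul_one]

/-- The coefficients `tr (ρ c_k c_l)` of the Choi–Jamiołkowski state. -/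
noncomputable def corr (E : SuperOp M) (k l : MajIdx M ⊕ MajIdx M) : ℂ :=
  (cjState E * (doubledMajorana k * doubledMajorana l)).trace

/-- The linear combination of Majorana operators to which the twisted dual map of a Gaussian map
sends a Majorana operator. -/
noncomputable def imageMajorana (E : SuperOp M) (b : MajIdx M) : Op M :=
  Complex.I • ∑ a, corr E (Sum.inl b) (Sum.inr a) • majorana a

/-! ### Wick recursions for the dual of a Gaussian map. -/

variable {E : SuperOp M}

/-- The norm of |Φ⁺⟩ need not be computed: the CJ state has trace one and a trace-preserving map
does not change the trace. -/
theorem trace_maxEntangled (hE : ∀ X : Op M, (E X).trace = X.trace)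
    (hρ : GaussianProperties doubledMajorana (cjState E)) : (maxEntangled M).trace = 1 := by
  have := trace_cjState_mul E 1 1
  rw [dualMap_one hE, pairing_apply, Matrix.one_kronecker_one, mul_one, mul_one,
    hρ.trace_eq_one] at this
  exact this.symm

/-- Both |Φ⁺⟩⟨Φ⁺| and the CJ state commute with P ⊗ P, so the map between them is parity covariant.
-/
theorem dualMap_conj_parity (hE : ∀ X : Op M, (E X).trace = X.trace)
    (hρ : GaussianProperties doubledMajorana (cjState E)) (Z : Op M) :
    dualMap E (parity M * Z * parity M) = parity M * dualMap E Z * parity M := by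
  refine eq_of_pairing_eq (trace_maxEntangled hE hρ) fun W => ?_
  have hg := hρ.commute_of_anticommute _ parity_kronecker_mul_doubledMajorana
  have e : (parity M * Z * parity M) ⊗ₖ W =
      (parity M ⊗ₖ parity M) * (Z ⊗ₖ (parity M * W * parity M)) * (parity M ⊗ₖ parity M) := by
    simp only [← Matrix.mul_kronecker_mul]
    congr 1
    rw [← mul_assoc, ← mul_assoc, parity_mul_self, one_mul, mul_assoc, parity_mul_self, mul_one]
  rw [pairing_conj_parity, ← trace_cjState_mul, ← trace_cjState_mul, e, ← mul_assoc, ← mul_assoc,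
    Matrix.trace_mul_comm, ← mul_assoc, ← mul_assoc, hg, mul_assoc (cjState E),
    ← Matrix.mul_kronecker_mul, parity_mul_self, Matrix.one_kronecker_one, mul_one]

theorem parity_mul_dualMap (hE : ∀ X : Op M, (E X).trace = X.trace)
    (hρ : GaussianProperties doubledMajorana (cjState E)) (Z : Op M) :
    parity M * dualMap E (parity M * Z) = twistedDualMap E Z := by
  have := dualMap_conj_parity hE hρ (Z * parity M)
  rw [mul_assoc, mul_assoc, parity_mul_self, mul_one] at this
  rw [this, twistedDualMap_apply, ← mul_assoc, ← mul_assoc, parity_mul_self, one_mul]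

theorem trace_cjState_mul_ancilla (Z W : Op M) (a : MajIdx M) :
    (cjState E * (Z ⊗ₖ W * doubledMajorana (Sum.inr a))).trace =
      -Complex.I * pairing W (twistedDualMap E Z * majorana a) := by
  rw [doubledMajorana, ← Matrix.mul_kronecker_mul, trace_cjState_mul, pairing_mul_majorana,
    twistedDualMap_apply, mul_assoc _ (parity M), parity_mul_majorana]
  simp

theorem trace_cjState_ancilla_mul (hE : ∀ X : Op M, (E X).trace = X.trace)
    (hρ : GaussianProperties doubledMajorana (cjState E)) (Z W : Op M) (a : MajIdx M) :
    (cjState E * (doubledMajorana (Sum.inr a) * Z ⊗ₖ W)).trace =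
      Complex.I * pairing W (majorana a * twistedDualMap E Z) := by
  rw [doubledMajorana, ← Matrix.mul_kronecker_mul, trace_cjState_mul, pairing_majorana_mul,
    mul_assoc, parity_mul_dualMap hE hρ]

theorem trace_cjState_mul_system (Z W : Op M) (a : MajIdx M) :
    (cjState E * (Z ⊗ₖ W * doubledMajorana (Sum.inl a))).trace =
      pairing W (dualMap E (Z * majorana a)) := by
  rw [doubledMajorana, ← Matrix.mul_kronecker_mul, trace_cjState_mul, mul_one]

theorem trace_cjState_system_mul (Z W : Op M) (a : MajIdx M) :
    (cjState E * (doubledMajorana (Sum.inl a) * Z ⊗ₖ W)).trace =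
      pairing W (dualMap E (majorana a * Z)) := by
  rw [doubledMajorana, ← Matrix.mul_kronecker_mul, trace_cjState_mul, one_mul]

/-- Wick's recursion for a system Majorana operator. Its system terms give the sum; its ancilla
terms, moved to the system by transfer, turn the anticommutator into a commutator with
`imageMajorana`, since the string P flips one sign. Nondegeneracy of the pairing removes `W`. -/
theorem two_smul_dualMap_majorana_mul (hE : ∀ X : Op M, (E X).trace = X.trace)
    (hρ : GaussianProperties doubledMajorana (cjState E)) (b : MajIdx M) (Z : Op M) :
    (2 : ℂ) • dualMap E (majorana b * Z) =
      (∑ a, corr E (Sum.inl b) (Sum.inl a) • dualMap E (Z * majorana a + majorana a * Z)) -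
        (twistedDualMap E Z * imageMajorana E b - imageMajorana E b * twistedDualMap E Z) := by
  refine eq_of_pairing_eq (trace_maxEntangled hE hρ) fun W => ?_
  have := hρ.wick doubledMajorana_isCAR (Sum.inl b) (Z ⊗ₖ W)
  simp only [Fintype.sum_sum_type, mul_add, Matrix.trace_add, trace_cjState_mul_system,
    trace_cjState_system_mul, trace_cjState_mul_ancilla, trace_cjState_ancilla_mul hE hρ] at this
  simp only [imageMajorana, map_sub, map_sum, map_smul, smul_eq_mul, map_add, mul_smul_comm,
    smul_mul_assoc, Finset.mul_sum, Finset.sum_mul, Finset.smul_sum]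
  rw [this, ← Finset.sum_sub_distrib, sub_eq_add_neg, ← Finset.sum_neg_distrib]
  refine congrArg₂ (· + ·) ?_ ?_
  · refine Finset.sum_congr rfl fun a _ => ?_
    simp only [corr, mul_add]
  · refine Finset.sum_congr rfl fun a _ => ?_
    simp only [corr]
    ring

/-- This is the preceding recursion at Z P, multiplied by P; moving P past a Majorana operator
exchanges commutators and anticommutators. -/
theorem two_smul_twistedDualMap_majorana_mul (hE : ∀ X : Op M, (E X).trace = X.trace)
    (hρ : GaussianProperties doubledMajorana (cjState E)) (b : MajIdx M) (Z : Op M) :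
    (2 : ℂ) • twistedDualMap E (majorana b * Z) =
      (∑ a, corr E (Sum.inl b) (Sum.inl a) •
        twistedDualMap E (majorana a * Z - Z * majorana a)) +
        (dualMap E Z * imageMajorana E b + imageMajorana E b * dualMap E Z) := by
  have hg : parity M * imageMajorana E b = -(imageMajorana E b * parity M) := by
    simp only [imageMajorana, mul_smul_comm, smul_mul_assoc, Finset.mul_sum, Finset.sum_mul,
      parity_mul_majorana, smul_neg, Finset.sum_neg_distrib]
  have h := congrArg (· * parity M) (two_smul_dualMap_majorana_mul hE hρ b (Z * parity M))
  simp only [sub_mul, twistedDualMap_mul_parity, smul_mul_assoc, Finset.sum_mul] at h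
  rw [twistedDualMap_apply, mul_assoc, h]
  rw [sub_eq_add_neg]
  refine congrArg₂ (· + ·) ?_ ?_
  · refine Finset.sum_congr rfl fun a _ => ?_
    have e : Z * parity M * majorana a + majorana a * (Z * parity M) =
        (majorana a * Z - Z * majorana a) * parity M := by
      rw [sub_mul, mul_assoc Z, parity_mul_majorana, mul_neg, ← mul_assoc, ← mul_assoc]; abel
    rw [twistedDualMap_apply, e]
  · rw [mul_assoc _ (parity M), hg]
    simp only [mul_neg, neg_mul, mul_assoc, parity_mul_self, mul_one]
    abel

theorem twistedDualMap_majorana (hE : ∀ X : Op M, (E X).trace = X.trace)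
    (hρ : GaussianProperties doubledMajorana (cjState E)) (b : MajIdx M) :
    twistedDualMap E (majorana b) = imageMajorana E b := by
  have := two_smul_twistedDualMap_majorana_mul hE hρ b 1
  simp only [mul_one, one_mul, sub_self, map_zero, smul_zero, Finset.sum_const_zero, zero_add,
    dualMap_one hE, ← two_smul ℂ] at this
  exact smul_right_injective _ (two_ne_zero (α := ℂ)) this

/-- Since F(1) = 1, the ancilla correlations are those of |Φ⁺⟩. For `e ≠ a`, transferring from the
right or from the left expresses them through c_a c_e or through c_e c_a, which are opposite. -/
theorem corr_ancilla (hE : ∀ X : Op M, (E X).trace = X.trace)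
    (hρ : GaussianProperties doubledMajorana (cjState E)) (e a : MajIdx M) :
    corr E (Sum.inr e) (Sum.inr a) = if e = a then 1 else 0 := by
  have hcorr : corr E (Sum.inr e) (Sum.inr a) = pairing (majorana e * majorana a) 1 := by
    rw [corr, doubledMajorana, doubledMajorana, ← Matrix.mul_kronecker_mul, parity_mul_self,
      trace_cjState_mul, dualMap_one hE]
  rw [hcorr]
  split_ifs with h
  · rw [h, majorana_mul_self, pairing_apply, Matrix.one_kronecker_one, mul_one,
      trace_maxEntangled hE hρ]
  · have h1 := pairing_mul_majorana (majorana e) 1 a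
    have h2 := pairing_majorana_mul (majorana a) 1 e
    have h3 := pairing_mul_majorana 1 (majorana a * parity M) e
    rw [one_mul] at h3
    have h4 := pairing_mul_majorana 1 (majorana e * parity M) a
    rw [one_mul] at h4
    rw [one_mul, h3, majorana_parity_mul, map_neg] at h1
    rw [mul_one, h4, majorana_parity_mul, map_neg] at h2
    have h5 : pairing 1 (majorana e * majorana a) = -pairing 1 (majorana a * majorana e) := by
      rw [majorana_anticomm h, map_neg]
    linear_combination (1 / 2 : ℂ) * h1 + (1 / 2 : ℂ) * h2 - (1 / 2 : ℂ) * Complex.I ^ 2 * h5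

/-- Wick's recursion for an ancilla Majorana operator. The ancilla block of correlations is the
identity, so half of the left side cancels and a commutator with P ⊗ c_e remains, which transfers to
an anticommutator on the system. -/
theorem twistedDualMap_anticommutator (hE : ∀ X : Op M, (E X).trace = X.trace)
    (hρ : GaussianProperties doubledMajorana (cjState E)) (e : MajIdx M) (Z : Op M) :
    majorana e * twistedDualMap E Z + twistedDualMap E Z * majorana e = -Complex.I •
      ∑ a, corr E (Sum.inr e) (Sum.inl a) • dualMap E (Z * majorana a + majorana a * Z) := by
  refine eq_of_pairing_eq (trace_maxEntangled hE hρ) fun W => ?_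
  have := hρ.wick doubledMajorana_isCAR (Sum.inr e) (Z ⊗ₖ W)
  simp only [Fintype.sum_sum_type, mul_add, Matrix.trace_add, trace_cjState_mul_system,
    trace_cjState_system_mul, trace_cjState_mul_ancilla, trace_cjState_ancilla_mul hE hρ] at this
  have hc : ∀ a, (cjState E * (doubledMajorana (Sum.inr e) * doubledMajorana (Sum.inr a))).trace =
      if e = a then 1 else 0 := corr_ancilla hE hρ e
  simp only [hc, ite_mul, one_mul, zero_mul, Finset.sum_add_distrib, Finset.sum_ite_eq,
    Finset.mem_univ, if_true] at this
  simp only [map_sum, map_smul, smul_eq_mul, map_add, mul_add, Finset.sum_add_distrib]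
  simp only [corr]
  linear_combination -Complex.I * this + (pairing W (majorana e * twistedDualMap E Z) +
    pairing W (twistedDualMap E Z * majorana e)) * Complex.I_sq

end Doubled

/-! ## Fully entangled vectors -/

section Entangled

variable {N : ℕ} {m : Fin N → ℕ}

theorem mode_injective (i : Fin N) : Function.Injective (mode m i) := by
  intro k l h
  have : (⟨i, k⟩ : Σ i : Fin N, Fin (m i)) = ⟨i, l⟩ := toLex.injective h
  simpa using this

theorem exists_mode_eq {i : Fin N} {k : Modes m} (h : party k = i) : ∃ l, mode m i l = k := by
  subst h; exact ⟨(ofLex k).2, rfl⟩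

theorem mode_mem_jointOccupation {i : Fin N} {S : Finset (Fin (m i))}
    {T : Finset (RestModes m i)} {k : Fin (m i)} :
    mode m i k ∈ jointOccupation m i S T ↔ k ∈ S := by
  simp only [jointOccupation, Finset.mem_union, Finset.mem_image]
  constructor
  · rintro (⟨l, hl, h⟩ | ⟨l, hl, h⟩)
    · exact mode_injective i h ▸ hl
    · exact absurd (by rw [h]; rfl) l.2
  · exact fun h => Or.inl ⟨k, h, rfl⟩

theorem rest_mem_jointOccupation {i : Fin N} {S : Finset (Fin (m i))}
    {T : Finset (RestModes m i)} {k : RestModes m i} :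
    (k : Modes m) ∈ jointOccupation m i S T ↔ k ∈ T := by
  simp only [jointOccupation, Finset.mem_union, Finset.mem_image]
  constructor
  · rintro (⟨l, hl, h⟩ | ⟨l, hl, h⟩)
    · exact absurd (by rw [← h]; rfl) k.2
    · exact Subtype.ext h ▸ hl
  · exact fun h => Or.inr ⟨k, h, rfl⟩

/-- The occupation of all modes as a pair of occupations. -/
noncomputable def jointEquiv (m : Fin N → ℕ) (i : Fin N) :
    Finset (Fin (m i)) × Finset (RestModes m i) ≃ Finset (Modes m) where
  toFun p := jointOccupation m i p.1 p.2
  invFun U := (Finset.univ.filter fun k => mode m i k ∈ U, Finset.univ.filter fun k => ↑k ∈ U)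
  left_inv p := by
    ext k <;> simp [mode_mem_jointOccupation, rest_mem_jointOccupation]
  right_inv U := by
    ext k
    by_cases hk : party k = i
    · obtain ⟨l, rfl⟩ := exists_mode_eq hk
      simp [mode_mem_jointOccupation]
    · have := rest_mem_jointOccupation (S := Finset.univ.filter fun k => mode m i k ∈ U)
        (T := Finset.univ.filter fun k => ↑k ∈ U) (k := (⟨k, hk⟩ : RestModes m i))
      simpa using this

theorem prod_jointOccupation {i : Fin N} (f : Modes m → ℂ) (S : Finset (Fin (m i)))
    (T : Finset (RestModes m i)) :
    ∏ k ∈ jointOccupation m i S T, f k = (∏ k ∈ S, f (mode m i k)) * ∏ k ∈ T, f k := by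
  rw [jointOccupation, Finset.prod_union, Finset.prod_image (mode_injective i).injOn,
    Finset.prod_image Subtype.val_injective.injOn]
  rw [Finset.disjoint_left]
  intro k hk hk'
  obtain ⟨a, -, rfl⟩ := Finset.mem_image.1 hk
  obtain ⟨b, -, h⟩ := Finset.mem_image.1 hk'
  exact b.2 (by rw [h]; rfl)

theorem mode_lt_mode {i : Fin N} {k l : Fin (m i)} : mode m i k < mode m i l ↔ k < l := by
  rw [Sigma.Lex.lt_def]
  constructor
  · rintro (h | ⟨_, h⟩)
    · exact absurd h (lt_irrefl i)
    · exact h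
  · exact fun h => Or.inr ⟨rfl, h⟩

theorem lt_mode_iff {i : Fin N} {k : Modes m} (hk : party k ≠ i) (l : Fin (m i)) :
    k < mode m i l ↔ party k < i := by
  rw [Sigma.Lex.lt_def]
  constructor
  · rintro (h | ⟨h, -⟩)
    · exact h
    · exact absurd h hk
  · exact fun h => Or.inl h

theorem symmDiff_jointOccupation [DecidableEq (Modes m)] {i : Fin N} (S : Finset (Fin (m i)))
    (T : Finset (RestModes m i)) (k : Fin (m i)) :
    symmDiff (jointOccupation m i S T) {mode m i k} = jointOccupation m i (symmDiff S {k}) T := by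
  ext l
  by_cases hl : party l = i
  · obtain ⟨l, rfl⟩ := exists_mode_eq hl
    simp [Finset.mem_symmDiff, mode_mem_jointOccupation, (mode_injective i).eq_iff]
  · have h1 := rest_mem_jointOccupation (S := S) (T := T) (k := (⟨l, hl⟩ : RestModes m i))
    have h2 := rest_mem_jointOccupation (S := symmDiff S {k}) (T := T)
      (k := (⟨l, hl⟩ : RestModes m i))
    have h3 : l ≠ mode m i k := by rintro rfl; exact hl rfl
    simp only at h1 h2
    simp [Finset.mem_symmDiff, h1, h2, h3]

/-- The Jordan–Wigner sign of the modes of the other parties preceding party `i`. -/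
noncomputable def stringOp (m : Fin N → ℕ) (i : Fin N) :
    Matrix (Finset (RestModes m i)) (Finset (RestModes m i)) ℂ :=
  Matrix.diagonal fun T => ∏ l ∈ T, if party (l : Modes m) < i then (-1 : ℂ) else 1

/-- The parity of the modes of the other parties. -/
noncomputable def restParity (m : Fin N → ℕ) (i : Fin N) :
    Matrix (Finset (RestModes m i)) (Finset (RestModes m i)) ℂ :=
  Matrix.diagonal fun T => (-1 : ℂ) ^ T.card

theorem stringOp_mul_self (i : Fin N) : stringOp m i * stringOp m i = 1 := by
  rw [stringOp, Matrix.diagonal_mul_diagonal, ← Matrix.diagonal_one]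
  congr 1
  ext T
  rw [← Finset.prod_mul_distrib]
  exact Finset.prod_eq_one fun l _ => by split_ifs <;> norm_num

/-- In the lexicographic order a mode of another party precedes either all modes of party `i` or
none. The Jordan–Wigner sign thus factorises, with the same string for all Majorana operators of the
party. -/
theorem localMajorana_submatrix (i : Fin N) (a : MajIdx (Fin (m i))) :
    (localMajorana m i a).submatrix (jointEquiv m i) (jointEquiv m i) =
      majorana a ⊗ₖ stringOp m i := by
  ext ⟨S, T⟩ ⟨S', T'⟩
  change majorana (mode m i a.1, a.2) (jointOccupation m i S T) (jointOccupation m i S' T') = _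
  rw [majorana_apply, Matrix.kronecker_apply, majorana_apply, stringOp, Matrix.diagonal_apply]
  dsimp only
  rw [@symmDiff_jointOccupation N m (fun a b => LinearOrder.toDecidableEq a b)]
  have hinj : jointOccupation m i S T = jointOccupation m i (symmDiff S' {a.1}) T' ↔
      S = symmDiff S' {a.1} ∧ T = T' := by
    have := (jointEquiv m i).injective.eq_iff (a := (S, T)) (b := (symmDiff S' {a.1}, T'))
    simpa [jointEquiv] using this
  simp only [hinj]
  by_cases hS : S = symmDiff S' {a.1}
  · by_cases hT : T = T'
    · simp only [hS, hT, and_self, if_true, majoranaWeight, prod_jointOccupation]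
      rw [mul_assoc]
      refine congrArg₂ (· * ·) rfl (congrArg₂ (· * ·) ?_ ?_)
      · refine Finset.prod_congr rfl fun k _ => ?_
        simp only [majoranaSign, mode_lt_mode, (mode_injective i).eq_iff]
      · refine Finset.prod_congr rfl fun k _ => ?_
        have h3 : (k : Modes m) ≠ mode m i a.1 := fun h => k.2 (by rw [h]; rfl)
        simp only [majoranaSign, lt_mode_iff k.2, h3, false_and, or_false]
    · simp [hT]
  · simp [hS]

theorem parity_submatrix (i : Fin N) :
    (parity (Modes m)).submatrix (jointEquiv m i) (jointEquiv m i) =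
      parity (Fin (m i)) ⊗ₖ restParity m i := by
  have hcard (S : Finset (Fin (m i))) (T : Finset (RestModes m i)) :
      (-1 : ℂ) ^ (jointOccupation m i S T).card = (-1) ^ S.card * (-1) ^ T.card := by
    have := prod_jointOccupation (fun _ => (-1 : ℂ)) S T
    simpa using this
  rw [parity, Matrix.submatrix_diagonal_equiv, parity, restParity,
    Matrix.diagonal_kronecker_diagonal]
  congr 1
  ext ⟨S, T⟩
  exact hcard S T

/-- The bound on the mode numbers makes the Schmidt rank equal to 2 ^ m i, so the coefficient matrix
has full row rank. -/
theorem exists_right_inverse (hm : ∀ i, m i ≤ modesOfRest m i)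
    {φ : EuclideanSpace ℂ (Finset (Modes m))} (hφ : IsFullyEntangled m φ) (i : Fin N) :
    ∃ R : Matrix (Finset (RestModes m i)) (Finset (Fin (m i))) ℂ,
      (Matrix.of fun S T => φ (jointOccupation m i S T)) * R = 1 := by
  obtain ⟨lam, η, ν, hlam, hη, hν, h⟩ := hφ i
  have hcard : Fintype.card (Fin (min (2 ^ m i) (2 ^ modesOfRest m i))) =
      Fintype.card (Finset (Fin (m i))) := by
    rw [Fintype.card_fin, Fintype.card_finset, Fintype.card_fin, min_eq_left]
    exact Nat.pow_le_pow_right (by norm_num) (hm i)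
  let A : Matrix (Finset (Fin (m i))) (Fin (min (2 ^ m i) (2 ^ modesOfRest m i))) ℂ :=
    Matrix.of fun S j => η j S
  let V : Matrix (Finset (RestModes m i)) (Fin (min (2 ^ m i) (2 ^ modesOfRest m i))) ℂ :=
    Matrix.of fun T j => ν j T
  have hA : Aᴴ * A = 1 := by
    ext j k
    have := orthonormal_iff_ite.1 hη j k
    rw [Matrix.one_apply, ← this, Matrix.mul_apply, PiLp.inner_apply]
    exact Finset.sum_congr rfl fun S _ => mul_comm _ _
  have hV : Vᵀ * (Vᴴ)ᵀ = 1 := by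
    rw [← Matrix.transpose_mul, ← Matrix.transpose_one]
    congr 1
    ext j k
    have := orthonormal_iff_ite.1 hν j k
    rw [Matrix.one_apply, ← this, Matrix.mul_apply, PiLp.inner_apply]
    exact Finset.sum_congr rfl fun S _ => mul_comm _ _
  -- There are as many Schmidt vectors as dimensions on the party's side, so the isometry is
  -- unitary.
  have hA' : A * Aᴴ = 1 := (Matrix.mul_eq_one_comm_of_card_eq _ _ _ hcard).1 hA
  have hD : Matrix.diagonal (fun j => (lam j : ℂ)) * Matrix.diagonal (fun j => (lam j : ℂ)⁻¹) =
      1 := by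
    rw [Matrix.diagonal_mul_diagonal, ← Matrix.diagonal_one]
    congr 1
    ext j
    exact mul_inv_cancel₀ (by exact_mod_cast (hlam j).ne')
  have hφ' : (Matrix.of fun S T => φ (jointOccupation m i S T)) =
      A * Matrix.diagonal (fun j => (lam j : ℂ)) * Vᵀ := by
    ext S T
    rw [Matrix.of_apply, h, Matrix.mul_apply]
    refine Finset.sum_congr rfl fun j _ => ?_
    rw [Matrix.mul_diagonal]
    simp only [A, V, Matrix.of_apply, Matrix.transpose_apply]
    ring
  refine ⟨(Vᴴ)ᵀ * (Matrix.diagonal (fun j => (lam j : ℂ)⁻¹) * Aᴴ), ?_⟩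
  rw [hφ', Matrix.mul_assoc, ← Matrix.mul_assoc Vᵀ, hV, Matrix.one_mul, Matrix.mul_assoc,
    ← Matrix.mul_assoc (Matrix.diagonal _), hD, Matrix.one_mul, hA']

theorem IsPureFermionic.exists_parity {M : Type} [LinearOrder M] [Fintype M]
    {ψ : EuclideanSpace ℂ (Finset M)} (hψ : IsPureFermionic ψ) :
    ∃ p : ℂ, p * p = 1 ∧ parity M *ᵥ ψ.ofLp = p • ψ.ofLp := by
  have hne : ∃ S, ψ S ≠ 0 := by
    by_contra h
    push Not at h
    have : ψ = 0 := by ext S; simpa using h S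
    have h1 := hψ.1
    rw [this, norm_zero] at h1
    exact zero_ne_one h1
  obtain ⟨S, hS⟩ := hne
  refine ⟨(-1) ^ S.card, by rw [← mul_pow]; norm_num, ?_⟩
  ext T
  have h := congrFun (congrFun hψ.2.eq T) S
  rw [parity, Matrix.mul_diagonal, Matrix.diagonal_mul] at h
  simp only [proj, Matrix.of_apply] at h
  rw [parity, Matrix.mulVec_diagonal, Pi.smul_apply, smul_eq_mul]
  have hS' : star (ψ S) ≠ 0 := by simpa using hS
  apply mul_right_cancel₀ hS'
  linear_combination -h

/-- A fully entangled vector of definite parity can be mapped to any vector by an operator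
anticommuting with the Majorana operators of a given party. -/
theorem exists_anticommuting_mulVec (hm : ∀ i, m i ≤ modesOfRest m i)
    {φ : EuclideanSpace ℂ (Finset (Modes m))} (hφ : IsPureFermionic φ)
    (hφ' : IsFullyEntangled m φ) (i : Fin N) (χ : Finset (Modes m) → ℂ) :
    ∃ Y : Op (Modes m), (∀ a, localMajorana m i a * Y = -(Y * localMajorana m i a)) ∧
      Y *ᵥ φ.ofLp = χ := by
  obtain ⟨p, hp, hpφ⟩ := hφ.exists_parity
  obtain ⟨R, hR⟩ := exists_right_inverse hm hφ' i
  set Q := stringOp m i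
  set P := restParity m i
  set e := jointEquiv m i with he
  have hQ : Q * Q = 1 := stringOp_mul_self i
  have hQP : Q * P = P * Q := by
    simp only [Q, P, stringOp, restParity, Matrix.diagonal_mul_diagonal, mul_comm]
  -- The operator 1 ⊗ y acts on coefficient matrices by right multiplication with yᵀ, so this `y`
  -- sends φ to χ.
  let y := (R * Matrix.of fun S T => χ (jointOccupation m i S T))ᵀ
  -- The parts of `y` commuting and anticommuting with the string Q.
  let yc := (1 / 2 : ℂ) • (y + Q * y * Q)
  let ya := (1 / 2 : ℂ) • (y - Q * y * Q)
  have hyc : Q * yc = yc * Q := by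
    simp only [yc, mul_smul_comm, smul_mul_assoc, mul_add, add_mul]
    rw [mul_assoc, mul_assoc, mul_assoc, hQ, ← mul_assoc Q Q, hQ, mul_one, one_mul, add_comm]
  have hya : Q * ya = -(ya * Q) := by
    simp only [ya, mul_smul_comm, smul_mul_assoc, mul_sub, sub_mul]
    rw [mul_assoc, mul_assoc, mul_assoc, hQ, ← mul_assoc Q Q, hQ, mul_one, one_mul, ← smul_neg,
      neg_sub]
  have hy : yc + ya = y := by
    simp only [yc, ya, ← smul_add]
    rw [add_add_sub_cancel, ← two_smul ℂ, smul_smul]; norm_num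
  -- The part `ya` already anticommutes with c ⊗ Q. The part `yc` commutes, so it is multiplied by
  -- the total parity; on φ this is the sign p, undone by the prefactor as p² = 1.
  let Y' : Matrix (Finset (Fin (m i)) × Finset (RestModes m i))
      (Finset (Fin (m i)) × Finset (RestModes m i)) ℂ :=
    p • (parity (Fin (m i)) ⊗ₖ (yc * P)) + 1 ⊗ₖ ya
  let φ' : Finset (Fin (m i)) × Finset (RestModes m i) → ℂ := φ.ofLp ∘ e
  have hPφ : (parity (Fin (m i)) ⊗ₖ P) *ᵥ φ' = p • φ' := by
    rw [← parity_submatrix, Matrix.submatrix_mulVec_equiv]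
    simp only [φ', Function.comp_assoc, ← he, Equiv.self_comp_symm, Function.comp_id, hpφ]
    rfl
  have hYφ : Y' *ᵥ φ' = χ ∘ e := by
    have h1 : parity (Fin (m i)) ⊗ₖ (yc * P) =
        ((1 : Op (Fin (m i))) ⊗ₖ yc) * (parity (Fin (m i)) ⊗ₖ P) := by
      rw [← Matrix.mul_kronecker_mul, one_mul]
    rw [Matrix.add_mulVec, Matrix.smul_mulVec, h1, ← Matrix.mulVec_mulVec, hPφ,
      Matrix.mulVec_smul, smul_smul, hp, one_smul, ← Matrix.add_mulVec, ← Matrix.kronecker_add, hy]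
    ext ⟨S, T⟩
    have h2 : (Matrix.of fun S T => φ (jointOccupation m i S T)) *
        (R * Matrix.of fun S T => χ (jointOccupation m i S T)) =
        Matrix.of fun S T => χ (jointOccupation m i S T) := by
      rw [← Matrix.mul_assoc, hR, Matrix.one_mul]
    have h3 := congrFun (congrFun h2 S) T
    rw [Matrix.mul_apply] at h3
    rw [Matrix.mulVec, dotProduct, Fintype.sum_prod_type, Finset.sum_eq_single S]
    · refine Eq.trans ?_ h3
      refine Finset.sum_congr rfl fun T' _ => ?_
      rw [Matrix.kronecker_apply, Matrix.one_apply_eq, one_mul, mul_comm]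
      rfl
    · intro S' _ hS'
      exact Finset.sum_eq_zero fun T' _ => by
        rw [Matrix.kronecker_apply, Matrix.one_apply_ne (Ne.symm hS')]; simp
    · simp
  refine ⟨Y'.submatrix e.symm e.symm, fun a => ?_, ?_⟩
  · have h1 : (majorana a ⊗ₖ Q) * Y' = -(Y' * (majorana a ⊗ₖ Q)) := by
      have hneg (A : Op (Fin (m i)))
          (B : Matrix (Finset (RestModes m i)) (Finset (RestModes m i)) ℂ) :
          (-A) ⊗ₖ B = -(A ⊗ₖ B) := by ext; simp
      have hneg' (A : Op (Fin (m i)))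
          (B : Matrix (Finset (RestModes m i)) (Finset (RestModes m i)) ℂ) :
          A ⊗ₖ (-B) = -(A ⊗ₖ B) := by ext; simp
      simp only [Y', mul_add, add_mul, mul_smul_comm, smul_mul_assoc, ← Matrix.mul_kronecker_mul,
        parity_mul_majorana, hneg, mul_one, one_mul, hya, hneg', neg_add, smul_neg, neg_neg]
      rw [← mul_assoc, hyc, mul_assoc, hQP, mul_assoc]
    have h2 : localMajorana m i a = (majorana a ⊗ₖ Q).submatrix e.symm e.symm := by
      rw [← localMajorana_submatrix, Matrix.submatrix_submatrix]
      simp [he]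
    rw [h2, Matrix.submatrix_mul_equiv, Matrix.submatrix_mul_equiv, h1]
    rfl
  · rw [Matrix.submatrix_mulVec_equiv]
    ext U
    have := congrFun hYφ (e.symm U)
    simpa [φ'] using this

end Entangled

/-! ## Unitaries implementing orthogonal transformations -/

section Implement

variable {n κ : Type} [Fintype n] [DecidableEq n] [Fintype κ] [DecidableEq κ]

/-- The real linear combination of the operators `c` with coefficients `w`. -/
noncomputable def combination (c : κ → Matrix n n ℂ) (w : EuclideanSpace ℝ κ) : Matrix n n ℂ :=
  ∑ k, (w k : ℂ) • c k

omit [Fintype n] [DecidableEq n] [DecidableEq κ] in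
theorem combination_sub (c : κ → Matrix n n ℂ) (v w : EuclideanSpace ℝ κ) :
    combination c (v - w) = combination c v - combination c w := by
  simp [combination, sub_smul]

omit [Fintype n] [DecidableEq n] [DecidableEq κ] in
theorem combination_smul (c : κ → Matrix n n ℂ) (r : ℝ) (w : EuclideanSpace ℝ κ) :
    combination c (r • w) = (r : ℂ) • combination c w := by
  rw [combination, combination, Finset.smul_sum]
  refine Finset.sum_congr rfl fun k _ => ?_
  rw [smul_smul]
  congr 1
  simp

omit [DecidableEq κ] [Fintype n] [DecidableEq n] in
theorem combination_conjTranspose {c : κ → Matrix n n ℂ} (hherm : ∀ a, (c a)ᴴ = c a)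
    (w : EuclideanSpace ℝ κ) : (combination c w)ᴴ = combination c w := by
  simp [combination, Matrix.conjTranspose_sum, hherm]

theorem IsCAR.combination_anticommutator {c : κ → Matrix n n ℂ} (hc : IsCAR c)
    (v w : EuclideanSpace ℝ κ) :
    combination c v * combination c w =
      (2 * (inner ℝ v w : ℝ) : ℂ) • (1 : Matrix n n ℂ) - combination c w * combination c v := by
  have e1 : combination c v * combination c w = ∑ k, ∑ l, ((v k : ℂ) * w l) • (c k * c l) := by
    simp only [combination, Finset.sum_mul, Finset.mul_sum, smul_mul_smul_comm]
    rw [Finset.sum_comm]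
  have e2 : combination c w * combination c v = ∑ k, ∑ l, ((v k : ℂ) * w l) • (c l * c k) := by
    simp only [combination, Finset.sum_mul, Finset.mul_sum, smul_mul_smul_comm]
    exact Finset.sum_congr rfl fun k _ => Finset.sum_congr rfl fun l _ => by rw [mul_comm]
  rw [eq_sub_iff_add_eq, e1, e2, ← Finset.sum_add_distrib, PiLp.inner_apply]
  push_cast
  rw [Finset.mul_sum, Finset.sum_smul]
  refine Finset.sum_congr rfl fun k _ => ?_
  rw [← Finset.sum_add_distrib, Finset.sum_eq_single k]
  · have h2 : (2 : Matrix n n ℂ) = (2 : ℂ) • 1 := by rw [two_smul, one_add_one_eq_two]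
    rw [← smul_add, hc k k, if_pos rfl, h2, smul_smul]
    congr 1
    have hi : (inner ℝ (v k) (w k) : ℝ) = w k * v k := by simp [mul_comm]
    rw [hi]
    push_cast
    ring
  · intro l _ hl
    rw [← smul_add, hc k l, if_neg (Ne.symm hl), smul_zero]
  · simp

/-- Every orthogonal transformation is implemented, up to a sign, by a unitary. -/
theorem exists_unitary_of_isometry {c : κ → Matrix n n ℂ} (hc : IsCAR c)
    (hherm : ∀ a, (c a)ᴴ = c a) (φ : EuclideanSpace ℝ κ ≃ₗᵢ[ℝ] EuclideanSpace ℝ κ) :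
    ∃ U ∈ Algebra.adjoin ℂ (Set.range c), ∃ s : ℝ, s * s = 1 ∧ Uᴴ * U = 1 ∧
      (∀ w, Uᴴ * combination c w * U = (s : ℂ) • combination c (φ w)) ∧
      ∀ X : Matrix n n ℂ, (∀ k, X * c k = -(c k * X)) → X * U = (s : ℂ) • (U * X) := by
  -- Cartan–Dieudonné: induct on a factorisation into hyperplane reflections.
  obtain ⟨l, -, rfl⟩ := φ.reflections_generate_dim
  induction l with
  | nil => exact ⟨1, one_mem _, 1, by norm_num, by simp, by simp, by simp⟩
  | cons v l ih =>
    obtain ⟨U, hU, s, hs, hUU, hUw, hUX⟩ := ih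
    set φ' := (l.map fun v => (ℝ ∙ v)ᗮ.reflection).prod
    by_cases hv : v = 0
    · refine ⟨U, hU, s, hs, hUU, fun w => ?_, hUX⟩
      rw [hUw, List.map_cons, List.prod_cons, LinearIsometryEquiv.coe_mul, Function.comp_apply]
      subst hv
      congr 2
      symm
      rw [Submodule.reflection_eq_self_iff]
      simp
    · have hv' : (‖v‖ : ℂ) ≠ 0 := by simpa using hv
      obtain ⟨u, hu⟩ : ∃ u, u = ((‖v‖ : ℂ)⁻¹) • combination c v := ⟨_, rfl⟩
      have huH : uᴴ = u := by
        rw [hu, Matrix.conjTranspose_smul, combination_conjTranspose hherm]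
        simp
      have huu : u * u = 1 := by
        have := hc.combination_anticommutator v v
        rw [eq_sub_iff_add_eq, ← two_smul ℂ, real_inner_self_eq_norm_sq, mul_smul] at this
        have := smul_right_injective _ (two_ne_zero (α := ℂ)) this
        rw [hu, smul_mul_smul_comm, this, smul_smul]
        push_cast
        rw [show (‖v‖ : ℂ)⁻¹ * (‖v‖ : ℂ)⁻¹ * (‖v‖ : ℂ) ^ 2 = 1 by field_simp, one_smul]
      -- Clifford conjugation by a unit vector is minus the reflection in its orthogonal hyperplane.
      -- This is the origin of the sign `s`, which flips with every genuine reflection.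
      have huw (w : EuclideanSpace ℝ κ) : u * combination c w * u =
          -combination c ((ℝ ∙ v)ᗮ.reflection w) := by
        have h1 : u * combination c w = ((‖v‖ : ℂ)⁻¹ * (2 * (inner ℝ v w : ℝ) : ℂ)) •
            (1 : Matrix n n ℂ) - combination c w * u := by
          rw [hu, smul_mul_assoc, hc.combination_anticommutator, smul_sub, smul_smul,
            mul_smul_comm]
        rw [h1, sub_mul, mul_assoc, huu, mul_one, smul_mul_assoc, one_mul, hu, smul_smul,
          Submodule.reflection_orthogonal_apply, Submodule.reflection_singleton_apply, neg_sub,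
          combination_sub, neg_sub]
        congr 1
        rw [← Nat.cast_smul_eq_nsmul ℝ, combination_smul, combination_smul, smul_smul]
        congr 1
        simp only [RCLike.ofReal_real_eq_id, id]
        push_cast
        field_simp
      have hmem : u ∈ Algebra.adjoin ℂ (Set.range c) := by
        rw [hu]
        refine Subalgebra.smul_mem _ (Subalgebra.sum_mem _ fun k _ => Subalgebra.smul_mem _ ?_ _) _
        exact Algebra.subset_adjoin ⟨k, rfl⟩
      refine ⟨U * u, mul_mem hU hmem, -s, by linarith, ?_, fun w => ?_, fun X hX => ?_⟩
      · rw [Matrix.conjTranspose_mul, huH, mul_assoc, ← mul_assoc Uᴴ, hUU, one_mul, huu]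
      · have : u * Uᴴ * combination c w * (U * u) = u * (Uᴴ * combination c w * U) * u := by
          simp only [mul_assoc]
        rw [Matrix.conjTranspose_mul, huH, this, hUw, mul_smul_comm, smul_mul_assoc, huw,
          List.map_cons, List.prod_cons, LinearIsometryEquiv.coe_mul, Function.comp_apply,
          Complex.ofReal_neg, neg_smul, smul_neg]
      · have hXu : X * u = -(u * X) := by
          simp only [hu, combination, mul_smul_comm, smul_mul_assoc, Finset.mul_sum,
            Finset.sum_mul, hX, smul_neg, Finset.sum_neg_distrib]
        rw [← mul_assoc, hUX X hX, smul_mul_assoc, mul_assoc, hXu]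
        simp [mul_assoc]

theorem exists_unitary_of_orthogonal {c : κ → Matrix n n ℂ} (hc : IsCAR c)
    (hherm : ∀ a, (c a)ᴴ = c a) {O : Matrix κ κ ℝ} (hO : O ∈ Matrix.orthogonalGroup κ ℝ) :
    ∃ U ∈ Algebra.adjoin ℂ (Set.range c), ∃ s : ℝ, s * s = 1 ∧ Uᴴ * U = 1 ∧
      (∀ a, Uᴴ * c a * U = (s : ℂ) • ∑ b, (O a b : ℂ) • c b) ∧
      ∀ X : Matrix n n ℂ, (∀ k, X * c k = -(c k * X)) → X * U = (s : ℂ) • (U * X) := by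
  have hO1 : O * Oᵀ = 1 := (Matrix.mem_orthogonalGroup_iff κ ℝ).1 hO
  -- The transpose appears because the basis vector `a` must be sent to row `a` of `O`.
  let f : EuclideanSpace ℝ κ →ₗᵢ[ℝ] EuclideanSpace ℝ κ :=
    (Matrix.toEuclideanLin Oᵀ).isometryOfInner fun v w => by
      simp only [EuclideanSpace.inner_eq_star_dotProduct, star_trivial,
        Matrix.ofLp_toLpLin, Matrix.toLin'_apply]
      rw [Matrix.dotProduct_mulVec, Matrix.vecMul_transpose, Matrix.mulVec_mulVec, hO1,
        Matrix.one_mulVec]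
  obtain ⟨U, hU, s, hs, hUU, hUw, hUX⟩ := exists_unitary_of_isometry hc hherm
    (f.toLinearIsometryEquiv rfl)
  refine ⟨U, hU, s, hs, hUU, fun a => ?_, hUX⟩
  have h := hUw (EuclideanSpace.single a 1)
  have h1 : combination c (EuclideanSpace.single a 1) = c a := by
    rw [combination, Finset.sum_eq_single a]
    · simp
    · intro b _ hb; simp [hb]
    · simp
  rw [h1] at h
  rw [h]
  congr 1
  refine Finset.sum_congr rfl fun b _ => ?_
  congr 2
  simp [f, Matrix.toLpLin_apply]

/-! ### Products of unitaries, one for each party. -/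

variable {N : ℕ}

omit [DecidableEq κ] in
/-- The product of local unitaries implements the direct sum of the local transformations. -/
theorem list_prod_conj (c A : κ → Matrix n n ℂ) (π : κ → Fin N) (U : Fin N → Matrix n n ℂ)
    (s : Fin N → ℝ) (O : Matrix κ κ ℝ) (hO : ∀ a b, π a ≠ π b → O a b = 0)
    (hA : ∀ a, A a = ∑ b, (O a b : ℂ) • c b)
    (hloc : ∀ a, (U (π a))ᴴ * c a * U (π a) = (s (π a) : ℂ) • A a)
    (hother : ∀ a i, π a ≠ i → (U i)ᴴ * c a * U i = (s i : ℂ) • c a)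
    (l : List (Fin N)) (hl : l.Nodup) (a : κ) :
    ((l.map U).prod)ᴴ * c a * (l.map U).prod =
      (((l.map s).prod : ℝ) : ℂ) • (if π a ∈ l then A a else c a) := by
  induction l generalizing a with
  | nil => simp
  | cons j l ih =>
    have hj := (List.nodup_cons.1 hl).1
    have ih := ih (List.nodup_cons.1 hl).2
    rw [List.map_cons, List.prod_cons, Matrix.conjTranspose_mul]
    have e : ((l.map U).prod)ᴴ * (U j)ᴴ * c a * (U j * (l.map U).prod) =
        ((l.map U).prod)ᴴ * ((U j)ᴴ * c a * U j) * (l.map U).prod := by simp only [mul_assoc]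
    rw [e]
    by_cases ha : π a = j
    · subst ha
      rw [hloc, mul_smul_comm, smul_mul_assoc, List.map_cons, List.prod_cons]
      -- `A a` involves only operators of its own party, which does not occur in `l`, so the
      -- remaining unitaries contribute signs only.
      have : ((l.map U).prod)ᴴ * A a * (l.map U).prod = (((l.map s).prod : ℝ) : ℂ) • A a := by
        simp only [hA, Finset.mul_sum, Finset.sum_mul, Finset.smul_sum, mul_smul_comm,
          smul_mul_assoc]
        refine Finset.sum_congr rfl fun b _ => ?_
        by_cases hb : π a = π b
        · rw [ih, if_neg (hb ▸ hj), smul_comm]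
        · simp [hO a b hb]
      rw [this, smul_smul]
      simp
    · rw [hother a j ha, mul_smul_comm, smul_mul_assoc, ih, smul_smul, List.map_cons,
        List.prod_cons]
      simp [ha]

theorem list_prod_unitary (U : Fin N → Matrix n n ℂ) (hU : ∀ i, (U i)ᴴ * U i = 1)
    (l : List (Fin N)) : ((l.map U).prod)ᴴ * (l.map U).prod = 1 := by
  induction l with
  | nil => simp
  | cons j l ih =>
    rw [List.map_cons, List.prod_cons, Matrix.conjTranspose_mul, mul_assoc, ← mul_assoc (U j)ᴴ,
      hU, one_mul, ih]

theorem mul_list_prod (U : Fin N → Matrix n n ℂ) (s : Fin N → ℝ) (X : Matrix n n ℂ)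
    (hU : ∀ i, X * U i = (s i : ℂ) • (U i * X)) (l : List (Fin N)) :
    X * (l.map U).prod = (((l.map s).prod : ℝ) : ℂ) • ((l.map U).prod * X) := by
  induction l with
  | nil => simp
  | cons j l ih =>
    rw [List.map_cons, List.prod_cons, ← mul_assoc, hU, smul_mul_assoc, mul_assoc, ih,
      mul_smul_comm, smul_smul, List.map_cons, List.prod_cons, mul_assoc]
    simp

end Implement

/-! ## Gaussian separable maps acting on fully entangled states -/

section Core

variable {M : Type} [LinearOrder M] [Fintype M] {N : ℕ} {E : SuperOp M}

theorem corr_add_corr (hρ : GaussianProperties doubledMajorana (cjState E))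
    (k l : MajIdx M ⊕ MajIdx M) : corr E k l + corr E l k = if k = l then 2 else 0 := by
  rw [corr, corr, doubledMajorana_isCAR.eq_sub k l, mul_sub, Matrix.trace_sub, mul_smul_comm,
    Matrix.trace_smul, mul_one, hρ.trace_eq_one]
  simp

theorem star_corr (hρ : GaussianProperties doubledMajorana (cjState E))
    (k l : MajIdx M ⊕ MajIdx M) : star (corr E k l) = corr E l k := by
  rw [corr, ← Matrix.trace_conjTranspose, Matrix.conjTranspose_mul, Matrix.conjTranspose_mul,
    doubledMajorana_conjTranspose, doubledMajorana_conjTranspose, hρ.isHermitian,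
    Matrix.trace_mul_comm]
  rfl

/-- The data of a Gaussian map with block-diagonal Choi–Jamiołkowski covariance that maps a pure
state `ψ` to a fully entangled pure state `φ`. -/
structure SeparableTransformation (π : M → Fin N) (E : SuperOp M) (ψ φ : Finset M → ℂ) : Prop where
  trace_eq : ∀ X : Op M, (E X).trace = X.trace
  gaussian : GaussianProperties doubledMajorana (cjState E)
  corr_eq_zero : ∀ k l : MajIdx M ⊕ MajIdx M,
    π (Sum.elim Prod.fst Prod.fst k) ≠ π (Sum.elim Prod.fst Prod.fst l) → corr E k l = 0
  ne_zero : ψ ≠ 0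
  parity_left : ∃ p : ℂ, parity M *ᵥ ψ = p • ψ
  parity_right : ∃ p : ℂ, parity M *ᵥ φ = p • φ
  dualMap_mulVec : ∀ Z : Op M, Z *ᵥ φ = 0 → dualMap E Z *ᵥ ψ = 0
  exists_anticommuting : ∀ (i : Fin N) (χ : Finset M → ℂ), ∃ Y : Op M,
    (∀ a : MajIdx M, π a.1 = i → majorana a * Y = -(Y * majorana a)) ∧ Y *ᵥ φ = χ

namespace SeparableTransformation

variable {π : M → Fin N} {ψ φ : Finset M → ℂ}

/-- Block-diagonality restricts every sum to the party of `b`, where anticommutators with `Y`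
vanish. By `twistedDualMap_anticommutator` the operator F̃(Y) also anticommutes with that party's
Majorana operators, hence with g_b, and the commutator in the recursion becomes twice a product. -/
theorem dualMap_majorana_mul (h : SeparableTransformation π E ψ φ) {b : MajIdx M} {Y : Op M}
    (hY : ∀ a : MajIdx M, π a.1 = π b.1 → majorana a * Y = -(Y * majorana a)) :
    dualMap E (majorana b * Y) = imageMajorana E b * twistedDualMap E Y := by
  have h3 (e : MajIdx M) (he : π e.1 = π b.1) :
      twistedDualMap E Y * majorana e = -(majorana e * twistedDualMap E Y) := by
    have := twistedDualMap_anticommutator h.trace_eq h.gaussian e Y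
    rw [Finset.sum_eq_zero, smul_zero] at this
    · exact eq_neg_of_add_eq_zero_right this
    · intro a _
      by_cases ha : π a.1 = π b.1
      · rw [hY a ha]; simp
      · rw [h.corr_eq_zero, zero_smul]
        exact fun h' => ha (h'.symm.trans he)
  have hg : twistedDualMap E Y * imageMajorana E b =
      -(imageMajorana E b * twistedDualMap E Y) := by
    simp only [imageMajorana, mul_smul_comm, smul_mul_assoc, Finset.mul_sum, Finset.sum_mul]
    rw [← smul_neg, ← Finset.sum_neg_distrib]
    congr 1
    refine Finset.sum_congr rfl fun a _ => ?_
    by_cases ha : π a.1 = π b.1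
    · rw [h3 a ha, smul_neg]
    · rw [h.corr_eq_zero (Sum.inl b) (Sum.inr a) (Ne.symm ha)]; simp
  have := two_smul_dualMap_majorana_mul h.trace_eq h.gaussian b Y
  rw [Finset.sum_eq_zero, hg, zero_sub, neg_sub, sub_neg_eq_add, ← two_smul ℂ] at this
  · exact smul_right_injective _ (two_ne_zero (α := ℂ)) this
  · intro a _
    by_cases ha : π a.1 = π b.1
    · rw [hY a ha]; simp
    · rw [h.corr_eq_zero (Sum.inl b) (Sum.inl a) (Ne.symm ha), zero_smul]

/-- On ψ the dual map sees only the action of its argument on φ, so c_d may be replaced by an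
operator `Y` with Yφ = c_d φ that anticommutes with the party of `b`; for it the dual map is
multiplicative. -/
theorem dualMap_majorana_mul_majorana_mulVec (h : SeparableTransformation π E ψ φ)
    (b d : MajIdx M) :
    dualMap E (majorana b * majorana d) *ᵥ ψ =
      (imageMajorana E b * imageMajorana E d) *ᵥ ψ := by
  obtain ⟨p, hp⟩ := h.parity_left
  obtain ⟨q, hq⟩ := h.parity_right
  obtain ⟨Y, hY, hYφ⟩ := h.exists_anticommuting (π b.1) (majorana d *ᵥ φ)
  have h0 : (Y - majorana d) *ᵥ φ = 0 := by rw [Matrix.sub_mulVec, hYφ, sub_self]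
  have h1 := h.dualMap_mulVec (majorana b * (Y - majorana d)) (by
    rw [← Matrix.mulVec_mulVec, h0, Matrix.mulVec_zero])
  have h2 := h.dualMap_mulVec ((Y - majorana d) * parity M) (by
    rw [← Matrix.mulVec_mulVec, hq, Matrix.mulVec_smul, h0, smul_zero])
  rw [mul_sub, map_sub, Matrix.sub_mulVec, sub_eq_zero] at h1
  have h3 : twistedDualMap E Y *ᵥ ψ = imageMajorana E d *ᵥ ψ := by
    rw [← twistedDualMap_majorana h.trace_eq h.gaussian, ← sub_eq_zero, ← Matrix.sub_mulVec,
      ← map_sub, twistedDualMap_apply, ← Matrix.mulVec_mulVec, hp, Matrix.mulVec_smul, h2,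
      smul_zero]
  rw [← h1, h.dualMap_majorana_mul hY, ← Matrix.mulVec_mulVec, h3, Matrix.mulVec_mulVec]

theorem imageMajorana_mul (b d : MajIdx M) :
    imageMajorana E b * imageMajorana E d + imageMajorana E d * imageMajorana E b =
      (2 * ∑ a, (Complex.I * corr E (Sum.inl b) (Sum.inr a)) *
        (Complex.I * corr E (Sum.inl d) (Sum.inr a))) • (1 : Op M) := by
  have hg (b : MajIdx M) : imageMajorana E b =
      ∑ a, (Complex.I * corr E (Sum.inl b) (Sum.inr a)) • majorana a := by
    simp only [imageMajorana, Finset.smul_sum, smul_smul]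
  have e1 : imageMajorana E b * imageMajorana E d = ∑ a, ∑ e,
      ((Complex.I * corr E (Sum.inl b) (Sum.inr a)) *
        (Complex.I * corr E (Sum.inl d) (Sum.inr e))) • (majorana a * majorana e) := by
    simp only [hg, Finset.sum_mul, Finset.mul_sum, smul_mul_smul_comm]
    rw [Finset.sum_comm]
  have e2 : imageMajorana E d * imageMajorana E b = ∑ a, ∑ e,
      ((Complex.I * corr E (Sum.inl b) (Sum.inr a)) *
        (Complex.I * corr E (Sum.inl d) (Sum.inr e))) • (majorana e * majorana a) := by
    simp only [hg, Finset.sum_mul, Finset.mul_sum, smul_mul_smul_comm]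
    exact Finset.sum_congr rfl fun a _ => Finset.sum_congr rfl fun e _ => by rw [mul_comm]
  have h2 : (2 : Op M) = (2 : ℂ) • 1 := by rw [two_smul, one_add_one_eq_two]
  rw [e1, e2, ← Finset.sum_add_distrib, Finset.mul_sum, Finset.sum_smul]
  refine Finset.sum_congr rfl fun a _ => ?_
  rw [← Finset.sum_add_distrib, Finset.sum_eq_single a]
  · rw [← smul_add, majorana_mul_add, if_pos rfl, h2, smul_smul, mul_comm]
  · intro e _ he
    rw [← smul_add, majorana_mul_add, if_neg (Ne.symm he), smul_zero]
  · simp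

/-- Two evaluations of F(c_b c_d)ψ are compared, one multiplicative and one by Wick's recursion.
Their difference is scalar, and ψ ≠ 0. -/
theorem corr_system (h : SeparableTransformation π E ψ φ) (b d : MajIdx M) :
    corr E (Sum.inl b) (Sum.inl d) = ∑ a, (Complex.I * corr E (Sum.inl b) (Sum.inr a)) *
        (Complex.I * corr E (Sum.inl d) (Sum.inr a)) := by
  have h1 := h.dualMap_majorana_mul_majorana_mulVec b d
  have h2 := two_smul_dualMap_majorana_mul h.trace_eq h.gaussian b (majorana d)
  have h3 : ∑ a, corr E (Sum.inl b) (Sum.inl a) •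
      dualMap E (majorana d * majorana a + majorana a * majorana d) =
      (2 * corr E (Sum.inl b) (Sum.inl d)) • (1 : Op M) := by
    rw [Finset.sum_eq_single d]
    · have e2 : (2 : Op M) = (2 : ℂ) • 1 := by rw [two_smul, one_add_one_eq_two]
      rw [majorana_mul_add, if_pos rfl, e2, map_smul, dualMap_one h.trace_eq, smul_smul, mul_comm]
    · intro a _ ha
      rw [majorana_mul_add, if_neg (Ne.symm ha), map_zero, smul_zero]
    · simp
  rw [h3, twistedDualMap_majorana h.trace_eq h.gaussian] at h2
  have h4 := imageMajorana_mul (E := E) b d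
  have h5 : (2 * corr E (Sum.inl b) (Sum.inl d)) • ψ = (2 * ∑ a,
      (Complex.I * corr E (Sum.inl b) (Sum.inr a)) *
      (Complex.I * corr E (Sum.inl d) (Sum.inr a))) • ψ := by
    have e (x : ℂ) : x • ψ = (x • (1 : Op M)) *ᵥ ψ := by
      rw [Matrix.smul_mulVec, Matrix.one_mulVec]
    rw [e, e, ← h4, ← add_eq_of_eq_sub h2, Matrix.add_mulVec, Matrix.smul_mulVec, h1,
      ← Matrix.smul_mulVec, ← Matrix.add_mulVec, two_smul]
    congr 1
    abel
  obtain ⟨S, hS⟩ := Function.ne_iff.1 h.ne_zero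
  have h6 := congrFun h5 S
  simp only [Pi.smul_apply, smul_eq_mul] at h6
  exact mul_left_cancel₀ (two_ne_zero) (mul_right_cancel₀ hS h6)

/-- By `corr_system` the correlations are symmetric, and the anticommutation relations fix their
symmetric part. -/
theorem corr_system_eq_ite (h : SeparableTransformation π E ψ φ) (b d : MajIdx M) :
    corr E (Sum.inl b) (Sum.inl d) = if b = d then 1 else 0 := by
  have h1 : corr E (Sum.inl b) (Sum.inl d) = corr E (Sum.inl d) (Sum.inl b) := by
    rw [h.corr_system b d, h.corr_system d b]
    exact Finset.sum_congr rfl fun a _ => mul_comm _ _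
  have h2 := corr_add_corr h.gaussian (Sum.inl b) (Sum.inl d)
  rw [← h1, ← two_mul] at h2
  apply mul_left_cancel₀ (two_ne_zero (α := ℂ))
  rw [h2]
  simp

theorem exists_orthogonal (h : SeparableTransformation π E ψ φ) :
    ∃ O : Matrix (MajIdx M) (MajIdx M) ℝ, O * Oᵀ = 1 ∧
      (∀ a b, π a.1 ≠ π b.1 → O a b = 0) ∧
      ∀ b, imageMajorana E b = ∑ a, (O b a : ℂ) • majorana a := by
  -- Hermiticity of the CJ state and anticommutation of system with ancilla make this correlation
  -- purely imaginary.
  have hreal (b a : MajIdx M) : (((Complex.I * corr E (Sum.inl b) (Sum.inr a)).re : ℝ) : ℂ) =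
      Complex.I * corr E (Sum.inl b) (Sum.inr a) := by
    rw [← Complex.conj_eq_iff_re, map_mul, Complex.conj_I]
    have h1 := star_corr h.gaussian (Sum.inl b) (Sum.inr a)
    have h2 := corr_add_corr h.gaussian (Sum.inl b) (Sum.inr a)
    rw [if_neg (by simp)] at h2
    change -Complex.I * star _ = _
    rw [h1]
    linear_combination -Complex.I * h2
  refine ⟨Matrix.of fun b a => (Complex.I * corr E (Sum.inl b) (Sum.inr a)).re, ?_, ?_, ?_⟩
  · ext b d
    have h1 := h.corr_system b d
    rw [h.corr_system_eq_ite] at h1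
    apply Complex.ofReal_injective
    rw [Matrix.mul_apply, Complex.ofReal_sum, Matrix.one_apply]
    simp only [Matrix.of_apply, Matrix.transpose_apply, Complex.ofReal_mul, hreal, ← h1]
    split_ifs <;> simp
  · intro a b hab
    rw [Matrix.of_apply, h.corr_eq_zero (Sum.inl a) (Sum.inr b) hab]
    simp
  · intro b
    simp only [imageMajorana, Finset.smul_sum, smul_smul, Matrix.of_apply, hreal]

/-- A unitary that acts on the Majorana operators like the map acts as the map. -/
theorem dualMap_eq_conj (h : SeparableTransformation π E ψ φ) {V : Op M} (hV : Vᴴ * V = 1)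
    {s : ℂ} (hs : s * s = 1) (hVm : ∀ b, Vᴴ * majorana b * V = s • imageMajorana E b)
    (hVP : parity M * V = s • (V * parity M)) (X : Op M) : dualMap E X = Vᴴ * X * V := by
  have hV' : V * Vᴴ = 1 := mul_eq_one_comm.1 hV
  have hmul (A B : Op M) : Vᴴ * (A * B) * V = (Vᴴ * A * V) * (Vᴴ * B * V) := by
    rw [mul_assoc (Vᴴ * A), ← mul_assoc V, ← mul_assoc V, hV', one_mul]
    simp only [mul_assoc]
  have hg (b : MajIdx M) : imageMajorana E b = s • (Vᴴ * majorana b * V) := by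
    rw [hVm, smul_smul, hs, one_smul]
  have h2 {A B : Op M} (h : (2 : ℂ) • A = (2 : ℂ) • B) : A = B :=
    smul_right_injective _ (two_ne_zero (α := ℂ)) h
  -- With the system correlations equal to δ, the sum in the recursion is a single (anti)commutator
  -- of c_b with a product not containing it. It vanishes for the anticommutator at odd length and
  -- the commutator at even length, so F̃ is tracked on odd products and F on even ones.
  have key (l : List (MajIdx M)) (hl : l.Nodup) :
      (Even l.length → dualMap E (majoranaProd l) = Vᴴ * majoranaProd l * V) ∧
      (Odd l.length → twistedDualMap E (majoranaProd l) = s • (Vᴴ * majoranaProd l * V)) := by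
    induction l with
    | nil => simp [hV, dualMap_one h.trace_eq]
    | cons b l ih =>
      obtain ⟨ih1, ih2⟩ := ih (List.nodup_cons.1 hl).2
      have hb := majoranaProd_mul_majorana (List.nodup_cons.1 hl).1
      have hsum {f : Op M → Op M} (g : MajIdx M → Op M) :
          ∑ a, corr E (Sum.inl b) (Sum.inl a) • f (g a) = f (g b) := by
        rw [Finset.sum_eq_single b]
        · simp [h.corr_system_eq_ite]
        · intro a _ ha; simp [h.corr_system_eq_ite, Ne.symm ha]
        · simp
      rw [List.length_cons, majoranaProd_cons]
      constructor
      · intro hl'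
        have hodd : Odd l.length := by
          rcases Nat.even_or_odd l.length with h' | h'
          · exact absurd hl' (Nat.not_even_iff_odd.2 h'.add_one)
          · exact h'
        rw [hodd.neg_one_pow, neg_one_smul] at hb
        apply h2
        rw [two_smul_dualMap_majorana_mul h.trace_eq h.gaussian, hsum, hb, neg_add_cancel,
          map_zero, zero_sub, neg_sub, ih2 hodd, hg, smul_mul_smul_comm, smul_mul_smul_comm, hs,
          one_smul, one_smul, ← hmul, ← hmul, hb, two_smul]
        simp
      · intro hl'
        have heven : Even l.length := by
          rcases Nat.even_or_odd l.length with h' | h'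
          · exact h'
          · exact absurd hl' (Nat.not_odd_iff_even.2 h'.add_one)
        rw [heven.neg_one_pow, one_smul] at hb
        apply h2
        rw [two_smul_twistedDualMap_majorana_mul h.trace_eq h.gaussian, hsum, hb, sub_self,
          map_zero, zero_add, ih1 heven, hg, mul_smul_comm, smul_mul_assoc, ← hmul, ← hmul, hb,
          two_smul]
  have hPV : Vᴴ * parity M * V = s • parity M := by
    rw [mul_assoc, hVP, mul_smul_comm, ← mul_assoc, hV, one_mul]
  -- X − PXP is twice the odd part of X; this extends the formula for F̃ from odd products to all
  -- odd operators.
  have hodd (X : Op M) : twistedDualMap E (X - parity M * X * parity M) =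
      s • (Vᴴ * (X - parity M * X * parity M) * V) := by
    let T : Op M →ₗ[ℂ] Op M := LinearMap.id -
      LinearMap.mulRight ℂ (parity M) ∘ₗ LinearMap.mulLeft ℂ (parity M)
    have : twistedDualMap E ∘ₗ T =
        (s • (LinearMap.mulRight ℂ V ∘ₗ LinearMap.mulLeft ℂ Vᴴ)) ∘ₗ T := by
      refine linearMap_ext_majoranaProd fun l hl => ?_
      have hT : T (majoranaProd l) =
          majoranaProd l - parity M * majoranaProd l * parity M := rfl
      rw [parity_mul_majoranaProd, smul_mul_assoc, mul_assoc, parity_mul_self, mul_one] at hT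
      rcases Nat.even_or_odd l.length with h' | h'
      · rw [h'.neg_one_pow, one_smul, sub_self] at hT
        rw [LinearMap.comp_apply, LinearMap.comp_apply, hT, map_zero, map_zero]
      · rw [h'.neg_one_pow, neg_one_smul, sub_neg_eq_add, ← two_smul ℂ] at hT
        rw [LinearMap.comp_apply, LinearMap.comp_apply, hT, map_smul, map_smul, (key l hl).2 h']
        rfl
    exact LinearMap.congr_fun this X
  have hall : dualMap E = LinearMap.mulRight ℂ V ∘ₗ LinearMap.mulLeft ℂ Vᴴ := by
    refine linearMap_ext_majoranaProd fun l hl => ?_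
    change _ = Vᴴ * majoranaProd l * V
    rcases Nat.even_or_odd l.length with h' | h'
    · exact (key l hl).1 h'
    · have h3 := hodd (majoranaProd l * parity M)
      have h4 : parity M * (majoranaProd l * parity M) * parity M =
          -(majoranaProd l * parity M) := by
        rw [← mul_assoc, parity_mul_majoranaProd, h'.neg_one_pow, mul_assoc, parity_mul_self]
        simp
      rw [h4, sub_neg_eq_add, ← two_smul ℂ, map_smul, mul_smul_comm, smul_mul_assoc,
        smul_comm s] at h3
      have h5 := h2 h3
      rw [twistedDualMap_mul_parity, hmul, hPV, mul_smul_comm, smul_smul, hs, one_smul] at h5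
      have h6 := congrArg (· * parity M) h5
      simpa only [mul_assoc, parity_mul_self, mul_one] using h6
  exact LinearMap.congr_fun hall X

theorem eq_conj (h : SeparableTransformation π E ψ φ) {V : Op M} (hV : Vᴴ * V = 1)
    {s : ℂ} (hs : s * s = 1) (hVm : ∀ b, Vᴴ * majorana b * V = s • imageMajorana E b)
    (hVP : parity M * V = s • (V * parity M)) (X : Op M) : E X = V * X * Vᴴ := by
  refine Matrix.ext_iff_trace_mul_left.2 fun Z => ?_
  rw [← trace_dualMap_mul, h.dualMap_eq_conj hV hs hVm hVP, mul_assoc, Matrix.trace_mul_comm,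
    ← mul_assoc, Matrix.trace_mul_comm]

end SeparableTransformation

end Core

/-! ## Gaussian separable maps -/

/-- Purify with a qubit. In the positive output matrix the corner block is |φ⟩⟨φ|, and a vector
killed by the corner of a positive matrix is killed by its off-diagonal blocks as well. Hence Z
E(|ψ⟩⟨T|) = 0, and its trace is the component at `T` of F(Z)ψ. -/
theorem IsCPTP.dualMap_mulVec {M : Type} [LinearOrder M] [Fintype M] {E : SuperOp M}
    (hE : IsCPTP E) {ψ φ : EuclideanSpace ℂ (Finset M)} (h : E (proj ψ) = proj φ) {Z : Op M}
    (hZ : Z *ᵥ φ.ofLp = 0) : dualMap E Z *ᵥ ψ.ofLp = 0 := by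
  ext T
  -- The vector ψ ⊗ |0⟩ + |T⟩ ⊗ |1⟩, whose off-diagonal block is |ψ⟩⟨T|.
  let x : Finset M × Fin 2 → ℂ := fun p => if p.2 = 0 then ψ p.1 else if p.1 = T then 1 else 0
  have hA := hE.1 2 _ (Matrix.posSemidef_vecMulVec_self_star x)
  set A := ampliation E (Matrix.vecMulVec x (star x)) with hAdef
  let B : Op M := Matrix.of fun S S' => ψ S * if S' = T then 1 else 0
  have h00 (S S' : Finset M) : A (S, 0) (S', 0) = φ S * star (φ S') := by
    change E (Matrix.of fun S T => x (S, 0) * star (x (T, 0))) S S' = _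
    have : (Matrix.of fun S T => x (S, 0) * star (x (T, 0))) = proj ψ := by
      ext S S'; exact congrArg₂ (fun a b : ℂ => a * star b) (if_pos rfl) (if_pos rfl)
    rw [this, h]; rfl
  have h01 (S S' : Finset M) : A (S, 0) (S', 1) = E B S S' := by
    change E (Matrix.of fun S T => x (S, 0) * star (x (T, 1))) S S' = _
    have : (Matrix.of fun S T => x (S, 0) * star (x (T, 1))) = B := by
      ext S S'
      refine (congrArg₂ (fun a b : ℂ => a * star b) (if_pos rfl) (if_neg one_ne_zero)).trans ?_
      by_cases hS : S' = T <;> simp [B, hS]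
    rw [this]
  have hrow (U S' : Finset M) : ∑ S, Z U S * E B S S' = 0 := by
    -- The conjugate of row `U` of `Z`, placed in the block of |0⟩; Zφ = 0 makes its quadratic form
    -- vanish.
    let w : Finset M × Fin 2 → ℂ := fun p => if p.2 = 0 then star (Z U p.1) else 0
    have hZU : ∑ S, Z U S * φ S = 0 := congrFun hZ U
    have hAw : (A *ᵥ w) = 0 := by
      rw [← hA.dotProduct_mulVec_zero_iff]
      simp only [dotProduct, Matrix.mulVec, Fintype.sum_prod_type, Fin.sum_univ_two, w,
        Pi.star_apply]
      simp only [if_true, star_star, Fin.one_eq_zero_iff, OfNat.ofNat_ne_one, if_false, mul_zero,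
        add_zero, star_zero, zero_mul, h00]
      have : ∀ S, Z U S * ∑ S', φ S * star (φ S') * star (Z U S') = 0 := by
        intro S
        have h2 : ∑ S', φ S * star (φ S') * star (Z U S') = φ S * star (∑ S', Z U S' * φ S') := by
          rw [star_sum, Finset.mul_sum]
          exact Finset.sum_congr rfl fun S' _ => by rw [star_mul']; ring
        rw [h2, hZU]; simp
      simp only [this, Finset.sum_const_zero]
    have h3 := congrFun hAw (S', 1)
    simp only [Matrix.mulVec, dotProduct, Fintype.sum_prod_type, Fin.sum_univ_two, w, if_true,
      Fin.one_eq_zero_iff, OfNat.ofNat_ne_one, if_false, mul_zero, add_zero, Pi.zero_apply] at h3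
    have h4 := congrArg star h3
    rw [star_sum, star_zero] at h4
    rw [← h4]
    refine Finset.sum_congr rfl fun S _ => ?_
    rw [star_mul', star_star, mul_comm, ← h01]
    congr 1
    exact (congrFun (congrFun hA.1 (S, 0)) (S', 1)).symm
  have hZB : Z * E B = 0 := by
    ext U S'
    rw [Matrix.mul_apply, hrow U S']; rfl
  have h5 := trace_dualMap_mul E Z B
  rw [hZB, Matrix.trace_zero] at h5
  have h6 : (dualMap E Z * B).trace = ∑ S, dualMap E Z T S * ψ S := by
    rw [Matrix.trace, Finset.sum_eq_single T]
    · rw [Matrix.diag_apply, Matrix.mul_apply]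
      exact Finset.sum_congr rfl fun S _ => by simp [B]
    · intro S _ hS
      rw [Matrix.diag_apply, Matrix.mul_apply]
      exact Finset.sum_eq_zero fun S' _ => by simp [B, hS]
    · simp
  exact h6.symm.trans h5

/-! ### From block-diagonal orthogonal matrices to Gaussian local unitaries. -/

section Parties

variable {N : ℕ} {m : Fin N → ℕ}

theorem IsGSEP.separableTransformation (hm : ∀ i, m i ≤ modesOfRest m i)
    {ψ φ : EuclideanSpace ℂ (Finset (Modes m))}
    (hψ : IsPureFermionic ψ) (hφ : IsPureFermionic φ) (hφ' : IsFullyEntangled m φ)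
    {E : SuperOp (Modes m)} (hE : IsGSEP m E) (h : E (proj ψ) = proj φ) :
    SeparableTransformation party E ψ.ofLp φ.ofLp := by
  obtain ⟨hCP, hG, hcov⟩ := hE
  have hρ : GaussianProperties doubledMajorana (cjState E) :=
    IsGaussianState.gaussianProperties doubledMajorana_isCAR doubledMajorana_conjTranspose hG
  refine ⟨hCP.2, hρ, fun k l hkl => ?_, fun h0 => ?_, ?_, ?_, fun Z hZ => hCP.dualMap_mulVec h hZ,
    fun i χ => ?_⟩
  · have h1 := hcov k l hkl
    rw [covariance, Matrix.of_apply, mul_sub, Matrix.trace_sub] at h1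
    have h2 := corr_add_corr hρ k l
    rw [if_neg (by rintro rfl; exact hkl rfl)] at h2
    have h3 : (2 * Complex.I) ≠ 0 := by simp
    have h4 : corr E k l - corr E l k = 0 := by
      rcases mul_eq_zero.1 h1 with h1 | h1
      · simp at h1
      · exact h1
    linear_combination (1 / 2 : ℂ) * h2 + (1 / 2 : ℂ) * h4
  · have h1 : ψ = 0 := by ext S; simpa using congrFun h0 S
    have h2 := hψ.1
    rw [h1, norm_zero] at h2
    exact zero_ne_one h2
  · obtain ⟨p, -, hp⟩ := hψ.exists_parity; exact ⟨p, hp⟩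
  · obtain ⟨p, -, hp⟩ := hφ.exists_parity; exact ⟨p, hp⟩
  · obtain ⟨Y, hY, hYφ⟩ := exists_anticommuting_mulVec hm hφ hφ' i χ
    refine ⟨Y, ?_, hYφ⟩
    rintro ⟨k, r⟩ ha
    obtain ⟨l, rfl⟩ := exists_mode_eq ha
    exact hY (l, r)

theorem localMajorana_isCAR (i : Fin N) : IsCAR (localMajorana m i) := by
  intro a b
  have h := majorana_mul_add (mode m i a.1, a.2) (mode m i b.1, b.2)
  have : (mode m i a.1, a.2) = (mode m i b.1, b.2) ↔ a = b := by
    rw [Prod.mk.injEq, (mode_injective i).eq_iff, ← Prod.ext_iff]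
  simp only [this] at h
  exact h

theorem sum_party {R : Type} [AddCommMonoid R] (i : Fin N) (g : MajIdx (Modes m) → R)
    (hg : ∀ a, party a.1 ≠ i → g a = 0) :
    ∑ a, g a = ∑ b : MajIdx (Fin (m i)), g (mode m i b.1, b.2) := by
  symm
  refine Finset.sum_of_injOn (fun b : MajIdx (Fin (m i)) => (mode m i b.1, b.2)) ?_ ?_ ?_ ?_
  · intro a _ b _ hab
    simp only [Prod.mk.injEq, (mode_injective i).eq_iff] at hab
    exact Prod.ext hab.1 hab.2
  · intro _ _; simp
  · rintro ⟨k, r⟩ _ ha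
    refine hg _ fun hk => ha ?_
    obtain ⟨l, rfl⟩ := exists_mode_eq hk
    exact ⟨(l, r), by simp, rfl⟩
  · intro _ _; rfl

/-- Block-diagonal orthogonal transformations are implemented by products of Gaussian local
unitaries, up to a sign. -/
theorem exists_localUnitaries {O : Matrix (MajIdx (Modes m)) (MajIdx (Modes m)) ℝ}
    (hO : O * Oᵀ = 1) (hblock : ∀ a b, party a.1 ≠ party b.1 → O a b = 0) :
    ∃ U : Fin N → Op (Modes m), (∀ i, IsGaussianLocalUnitary m i (U i)) ∧
      ((List.ofFn U).prod)ᴴ * (List.ofFn U).prod = 1 ∧ ∃ s : ℂ, s * s = 1 ∧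
      (∀ a, ((List.ofFn U).prod)ᴴ * majorana a * (List.ofFn U).prod =
        s • ∑ b, (O a b : ℂ) • majorana b) ∧
      parity (Modes m) * (List.ofFn U).prod = s • ((List.ofFn U).prod * parity (Modes m)) := by
  let Oi (i : Fin N) : Matrix (MajIdx (Fin (m i))) (MajIdx (Fin (m i))) ℝ :=
    Matrix.of fun a b => O (mode m i a.1, a.2) (mode m i b.1, b.2)
  have hOi (i : Fin N) : Oi i ∈ Matrix.orthogonalGroup (MajIdx (Fin (m i))) ℝ := by
    rw [Matrix.mem_orthogonalGroup_iff]
    ext a b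
    have h1 := congrFun (congrFun hO (mode m i a.1, a.2)) (mode m i b.1, b.2)
    rw [Matrix.mul_apply, sum_party i] at h1
    · refine Eq.trans h1 ?_
      have : (mode m i a.1, a.2) = (mode m i b.1, b.2) ↔ a = b := by
        rw [Prod.mk.injEq, (mode_injective i).eq_iff, ← Prod.ext_iff]
      simp only [Matrix.one_apply, this]
    · intro c hc
      rw [hblock (mode m i a.1, a.2) c (Ne.symm hc), zero_mul]
  have hex (i : Fin N) := exists_unitary_of_orthogonal (localMajorana_isCAR (m := m) i)
    (fun a => majorana_conjTranspose _) (hOi i)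
  choose U hU s hs hUU hUc hUX using hex
  -- The Majorana operators of the other parties are conjugated to s_i times themselves. The product
  -- of all U_i thus carries the same sign ∏ s_i on every Majorana operator.
  have hanti (i : Fin N) (X : Op (Modes m)) (hX : ∀ k, X * localMajorana m i k =
      -(localMajorana m i k * X)) : (U i)ᴴ * X * U i = (s i : ℂ) • X := by
    rw [mul_assoc, hUX i X hX, mul_smul_comm, ← mul_assoc, hUU, one_mul]
  -- The sign of each implementing unitary is absorbed into its orthogonal matrix.
  refine ⟨U, fun i => ⟨hU i, Matrix.mem_unitaryGroup_iff'.2 (hUU i), s i • Oi i, ?_,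
    fun a => ?_⟩, ?_, (((List.finRange N).map s).prod : ℝ), ?_, fun a => ?_, ?_⟩
  · rw [Matrix.mem_orthogonalGroup_iff, Matrix.transpose_smul, smul_mul_smul_comm, hs, one_smul]
    exact Matrix.mem_orthogonalGroup_iff _ _ |>.1 (hOi i)
  · rw [hUc, Finset.smul_sum]
    exact Finset.sum_congr rfl fun b _ => by
      rw [smul_smul, ← Complex.ofReal_mul, Matrix.smul_apply, smul_eq_mul]
  · rw [List.ofFn_eq_map]
    exact list_prod_unitary U hUU _
  · rw [← Complex.ofReal_mul, ← List.prod_map_mul]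
    simp [hs]
  · rw [List.ofFn_eq_map]
    have := list_prod_conj (fun a : MajIdx (Modes m) => majorana a)
      (fun a => ∑ b, (O a b : ℂ) • majorana b) (fun a => party a.1) U s O hblock (fun _ => rfl)
      ?_ ?_ (List.finRange N) (List.nodup_finRange N) a
    · simpa using this
    · rintro ⟨k, r⟩
      obtain ⟨l, hl⟩ := exists_mode_eq (rfl : party k = party k)
      have h1 := hUc (party k) (l, r)
      rw [sum_party (party k)]
      · rw [localMajorana, hl] at h1
        rw [h1]
        simp only [Oi, Matrix.of_apply, localMajorana, hl]
      · intro b hb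
        rw [hblock (k, r) b (Ne.symm hb)]; simp
    · intro a i ha
      refine hanti i _ fun k => majorana_anticomm ?_
      rintro rfl
      exact ha rfl
  · rw [List.ofFn_eq_map]
    exact mul_list_prod U s _ (fun i => hUX i _ fun k => parity_mul_majorana _) _

theorem IsGSEP.isProductOfGLU (hm : ∀ i, m i ≤ modesOfRest m i)
    {ψ φ : EuclideanSpace ℂ (Finset (Modes m))}
    (hψ : IsPureFermionic ψ) (hφ : IsPureFermionic φ) (hφ' : IsFullyEntangled m φ)
    {E : SuperOp (Modes m)} (hE : IsGSEP m E) (h : E (proj ψ) = proj φ) :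
    IsProductOfGLU m E := by
  have hS := hE.separableTransformation hm hψ hφ hφ' h
  obtain ⟨O, hO, hblock, himg⟩ := hS.exists_orthogonal
  obtain ⟨U, hU, hV, s, hs, hVm, hVP⟩ := exists_localUnitaries hO hblock
  refine ⟨U, hU, fun ρ => hS.eq_conj hV hs (fun b => ?_) hVP ρ⟩
  rw [himg b]
  exact hVm b

end Parties

/-! ## Gaussian local operations with classical communication -/

/-! ### Symmetries of maps under diagonal sign operators. -/

section CharOp

variable {M : Type} [LinearOrder M] [Fintype M] {e : M → ℂ}

theorem charOp_mul_parity (e : M → ℂ) : charOp e * parity M = parity M * charOp e := by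
  rw [parity_eq, charOp_mul, charOp_mul, mul_comm]

theorem charOp_conj_of_commute (he : ∀ k, e k * e k = 1) {A : Op M} (hA : Commute A (charOp e)) :
    charOp e * A * charOp e = A := by
  rw [← hA.eq, mul_assoc, charOp_mul_self e he, mul_one]

theorem charOp_conj_eq_parity_conj (he : ∀ k, e k * e k = 1) {A : Op M}
    (hA : Commute (charOp e * parity M) A) :
    charOp e * A * charOp e = parity M * A * parity M := by
  have h1 : charOp e * A = parity M * A * (parity M * charOp e) := by
    have h2 : parity M * (charOp e * parity M) = charOp e := by
      rw [charOp_mul_parity, ← mul_assoc, parity_mul_self, one_mul]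
    rw [mul_assoc, ← charOp_mul_parity, ← hA.eq, ← mul_assoc, h2]
  rw [h1, mul_assoc, mul_assoc (parity M) (charOp e), charOp_mul_self e he, mul_one]

theorem HasDefiniteParity.parity_conj {A : Op M} (hA : HasDefiniteParity A) :
    ∃ s : ℝ, s * s = 1 ∧ parity M * A * parity M = (s : ℂ) • A := by
  rcases hA with h | h
  · exact ⟨1, by norm_num, by rw [← h, mul_assoc, parity_mul_self]; simp⟩
  · exact ⟨-1, by norm_num, by
      rw [← neg_eq_iff_eq_neg.2 h, neg_mul, mul_assoc, parity_mul_self]; simp⟩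

/-- The sign picked up by `A` is picked up by its adjoint too, so it cancels in A ρ A†. -/
theorem charOp_conj_mul_mul_conjTranspose (he : ∀ k, e k * e k = 1)
    (he' : (charOp e)ᴴ = charOp e) {A : Op M} {s : ℝ} (hs : s * s = 1)
    (h : charOp e * A * charOp e = (s : ℂ) • A) (ρ : Op M) :
    A * (charOp e * ρ * charOp e) * Aᴴ = charOp e * (A * ρ * Aᴴ) * charOp e := by
  have h1 : A * charOp e = (s : ℂ) • (charOp e * A) := by
    rw [← mul_smul_comm, ← h, ← mul_assoc, ← mul_assoc, charOp_mul_self e he, one_mul]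
  have h2 : charOp e * Aᴴ = (s : ℂ) • (Aᴴ * charOp e) := by
    have := congrArg Matrix.conjTranspose h1
    simpa [Matrix.conjTranspose_mul, he'] using this
  rw [← mul_assoc, ← mul_assoc, h1, mul_assoc, h2, mul_smul_comm, smul_mul_assoc, smul_mul_assoc,
    smul_smul, ← Complex.ofReal_mul, hs, Complex.ofReal_one, one_smul]
  simp only [mul_assoc]

theorem charOp_kronecker_mul_doubledMajorana (he : ∀ k, e k * e k = 1)
    (k : MajIdx M ⊕ MajIdx M) :
    (charOp e ⊗ₖ charOp e) * doubledMajorana k =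
      e (Sum.elim Prod.fst Prod.fst k) • (doubledMajorana k * (charOp e ⊗ₖ charOp e)) := by
  rcases k with a | a
  · rw [doubledMajorana, ← Matrix.mul_kronecker_mul, ← Matrix.mul_kronecker_mul, mul_one, one_mul,
      charOp_mul_majorana e he, Matrix.smul_kronecker]
    rfl
  · rw [doubledMajorana, ← Matrix.mul_kronecker_mul, ← Matrix.mul_kronecker_mul,
      charOp_mul_majorana e he, Matrix.kronecker_smul, charOp_mul_parity]
    rfl

theorem charOp_kronecker_mul_doubledMajorana_mul (he : ∀ k, e k * e k = 1)
    (k l : MajIdx M ⊕ MajIdx M) :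
    (charOp e ⊗ₖ charOp e) * (doubledMajorana k * doubledMajorana l) =
      (e (Sum.elim Prod.fst Prod.fst k) * e (Sum.elim Prod.fst Prod.fst l)) •
        (doubledMajorana k * doubledMajorana l * (charOp e ⊗ₖ charOp e)) := by
  rw [← mul_assoc, charOp_kronecker_mul_doubledMajorana he, smul_mul_assoc, mul_assoc,
    charOp_kronecker_mul_doubledMajorana he, mul_smul_comm, smul_smul, mul_assoc]

theorem charOp_kronecker_mul_self (he : ∀ k, e k * e k = 1) :
    (charOp e ⊗ₖ charOp e) * (charOp e ⊗ₖ charOp e) = 1 := by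
  rw [← Matrix.mul_kronecker_mul, charOp_mul_self e he, Matrix.one_kronecker_one]

theorem commute_charOp_maxEntangled (he : ∀ k, e k * e k = 1) :
    Commute (charOp e ⊗ₖ charOp e) (maxEntangled M) := by
  refine commute_maxEntangled fun a => ?_
  rw [← stabilizer_eq]
  refine Commute.smul_right ?_ _
  rw [Commute, SemiconjBy, charOp_kronecker_mul_doubledMajorana_mul he]
  exact (congrArg (· • _) (he a.1)).trans (one_smul _ _)

theorem dualMap_charOp_conj {E : SuperOp M}
    (hE : ∀ ρ, E (charOp e * ρ * charOp e) = charOp e * E ρ * charOp e) (Z : Op M) :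
    dualMap E (charOp e * Z * charOp e) = charOp e * dualMap E Z * charOp e := by
  have hc (A B : Op M) : (charOp e * A * charOp e * B).trace =
      (A * (charOp e * B * charOp e)).trace := by
    rw [mul_assoc, mul_assoc, Matrix.trace_mul_comm]
    simp only [mul_assoc]
  rw [Matrix.ext_iff_trace_mul_right]
  intro X
  rw [trace_dualMap_mul, hc, hc, ← hE, trace_dualMap_mul]

theorem pairing_charOp_conj (he : ∀ k, e k * e k = 1) (W X : Op M) :
    pairing (charOp e * W * charOp e) (charOp e * X * charOp e) = pairing W X := by
  rw [pairing_apply, pairing_apply, Matrix.mul_kronecker_mul, Matrix.mul_kronecker_mul, ← mul_assoc,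
    ← mul_assoc, ← (commute_charOp_maxEntangled he).eq, Matrix.trace_mul_comm, ← mul_assoc,
    ← mul_assoc, charOp_kronecker_mul_self he, one_mul]

/-- A symmetry of the map that gives opposite signs to two Majorana operators makes their
correlation in the Choi–Jamiołkowski state vanish. -/
theorem corr_eq_zero_of_charOp_conj (he : ∀ k, e k * e k = 1) {E : SuperOp M}
    (hE : ∀ ρ, E (charOp e * ρ * charOp e) = charOp e * E ρ * charOp e)
    {k l : MajIdx M ⊕ MajIdx M}
    (hkl : e (Sum.elim Prod.fst Prod.fst k) * e (Sum.elim Prod.fst Prod.fst l) = -1) :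
    corr E k l = 0 := by
  obtain ⟨Z, W, hZW⟩ : ∃ Z W : Op M, doubledMajorana k * doubledMajorana l = Z ⊗ₖ W := by
    rcases k with a | a <;> rcases l with b | b <;>
      exact ⟨_, _, by rw [doubledMajorana, doubledMajorana, ← Matrix.mul_kronecker_mul]⟩
  have hc : (charOp e * Z * charOp e) ⊗ₖ (charOp e * W * charOp e) = -(Z ⊗ₖ W) := by
    rw [Matrix.mul_kronecker_mul, Matrix.mul_kronecker_mul, ← hZW,
      charOp_kronecker_mul_doubledMajorana_mul he, hkl, smul_mul_assoc, mul_assoc,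
      charOp_kronecker_mul_self he, mul_one, neg_one_smul]
  -- Covariance of E and invariance of |Φ⁺⟩⟨Φ⁺| leave the correlation unchanged, while the Majorana
  -- product changes sign.
  have h1 : (cjState E * (Z ⊗ₖ W)).trace = (cjState E * -(Z ⊗ₖ W)).trace := by
    rw [← hc, trace_cjState_mul, trace_cjState_mul, dualMap_charOp_conj hE, pairing_charOp_conj he]
  rw [mul_neg, Matrix.trace_neg] at h1
  rw [corr, hZW]
  linear_combination (1 / 2 : ℂ) * h1

end CharOp

/-! ### Covariance of protocols under local parities, and passage to limits. -/

section GLOCC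

variable {N : ℕ} {m : Fin N → ℕ}

/-- The sign that the parity of party `i` gives to a mode. -/
noncomputable def localSign (i : Fin N) (k : Modes m) : ℂ := if party k = i then -1 else 1

theorem localSign_mul_self (i : Fin N) (k : Modes m) : localSign i k * localSign i k = 1 := by
  unfold localSign; split_ifs <;> norm_num

/-- The parity of party `i`. -/
noncomputable def localParity (m : Fin N → ℕ) (i : Fin N) : Op (Modes m) := charOp (localSign i)

theorem localParity_conjTranspose (i : Fin N) : (localParity m i)ᴴ = localParity m i := by
  rw [localParity, charOp, Matrix.diagonal_conjTranspose]
  congr 1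
  ext S
  rw [Pi.star_apply, star_prod]
  exact Finset.prod_congr rfl fun k _ => by unfold localSign; split_ifs <;> simp

theorem localParity_mul_localMajorana (i j : Fin N) (a : MajIdx (Fin (m j))) :
    localParity m i * localMajorana m j a =
      (if j = i then (-1 : ℂ) else 1) • (localMajorana m j a * localParity m i) :=
  charOp_mul_majorana _ (localSign_mul_self i) _

/-- Operators of a party commute with whatever commutes with its Majorana operators. -/
theorem commute_of_mem_localAlgebra {i : Fin N} {A X : Op (Modes m)} (hA : A ∈ localAlgebra m i)
    (hX : ∀ a, Commute X (localMajorana m i a)) : Commute X A := by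
  induction hA using Algebra.adjoin_induction with
  | mem x hx => obtain ⟨a, rfl⟩ := hx; exact hX a
  | algebraMap r => exact Algebra.commute_algebraMap_right r X
  | add x y _ _ hx hy => exact hx.add_right hy
  | mul x y _ _ hx hy => exact hx.mul_right hy

/-- A local operator of definite parity is preserved up to sign by conjugation with the parity of
any party. -/
theorem exists_localParity_conj {i j : Fin N} {A : Op (Modes m)} (hA : A ∈ localAlgebra m j)
    (hP : HasDefiniteParity A) :
    ∃ s : ℝ, s * s = 1 ∧ localParity m i * A * localParity m i = (s : ℂ) • A := by
  by_cases hij : j = i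
  · obtain ⟨s, hs, h⟩ := hP.parity_conj
    refine ⟨s, hs, (charOp_conj_eq_parity_conj (localSign_mul_self i) ?_).trans h⟩
    -- The product of the local and the total parity is the parity of all other parties, which
    -- commutes with party `j`; so on its operators the two parities act alike.
    refine commute_of_mem_localAlgebra hA fun a => ?_
    change localParity m i * parity (Modes m) * localMajorana m j a =
      localMajorana m j a * (localParity m i * parity (Modes m))
    have hp : parity (Modes m) * localMajorana m j a = -(localMajorana m j a * parity (Modes m)) :=
      parity_mul_majorana _
    rw [mul_assoc, hp, mul_neg, ← mul_assoc, localParity_mul_localMajorana, if_pos hij,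
      neg_one_smul, neg_mul, neg_neg, mul_assoc]
  · refine ⟨1, by norm_num, ?_⟩
    rw [Complex.ofReal_one, one_smul]
    refine charOp_conj_of_commute (localSign_mul_self i) (Commute.symm ?_)
    refine commute_of_mem_localAlgebra hA fun a => ?_
    refine (localParity_mul_localMajorana i j a).trans ?_
    rw [if_neg hij, one_smul]
    rfl

theorem Protocol.run_localParity_conj (i : Fin N) (p : Protocol m) (hp : p.IsGaussianLocal)
    (ρ : Op (Modes m)) : p.run (localParity m i * ρ * localParity m i) =
      localParity m i * p.run ρ * localParity m i := by
  induction p generalizing ρ with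
  | halt => rfl
  | round j K A next ih =>
    obtain ⟨hA, -, hn⟩ := hp
    simp only [Protocol.run, Finset.mul_sum, Finset.sum_mul]
    refine Finset.sum_congr rfl fun k _ => ?_
    rw [← ih k (hn k)]
    obtain ⟨s, hs, h⟩ := exists_localParity_conj (i := i) (hA k).1 (hA k).2.1
    exact congrArg _ (charOp_conj_mul_mul_conjTranspose (localSign_mul_self i)
      (localParity_conjTranspose i) hs h ρ)

theorem Protocol.trace_run (p : Protocol m) (hp : p.IsGaussianLocal) (ρ : Op (Modes m)) :
    (p.run ρ).trace = ρ.trace := by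
  induction p generalizing ρ with
  | halt => rfl
  | round j K A next ih =>
    obtain ⟨-, hA, hn⟩ := hp
    rw [Protocol.run, Matrix.trace_sum]
    have : ∀ k, ((next k).run (A k * ρ * (A k)ᴴ)).trace = ((A k)ᴴ * A k * ρ).trace := fun k => by
      rw [ih k (hn k), Matrix.trace_mul_comm, ← mul_assoc]
    simp only [this]
    rw [← Matrix.trace_sum, ← Finset.sum_mul, hA, one_mul]

/-- Each branch amplifies to conjugation by A_k ⊗ 1, which preserves positivity, and branches are
summed. -/
theorem Protocol.posSemidef_run {d : ℕ} (p : Protocol m)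
    {X : Matrix (Finset (Modes m) × Fin d) (Finset (Modes m) × Fin d) ℂ} (hX : X.PosSemidef) :
    (Matrix.of fun a b : Finset (Modes m) × Fin d =>
      p.run (Matrix.of fun S T => X (S, a.2) (T, b.2)) a.1 b.1).PosSemidef := by
  induction p generalizing X with
  | halt => exact hX
  | round j K A next ih =>
    have h := Matrix.posSemidef_sum Finset.univ fun k (_ : k ∈ Finset.univ) =>
      ih k (hX.mul_mul_conjTranspose_same (A k ⊗ₖ (1 : Matrix (Fin d) (Fin d) ℂ)))
    convert h using 1
    ext a b
    rw [Matrix.sum_apply, Matrix.of_apply, Protocol.run, Matrix.sum_apply]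
    refine Finset.sum_congr rfl fun k _ => ?_
    rw [Matrix.of_apply]
    congr 2
    ext S T
    simp [Matrix.mul_apply, Fintype.sum_prod_type, Matrix.one_apply,
      Matrix.conjTranspose_kronecker]

/-- Positivity of each amplification and preservation of the trace are closed conditions under
pointwise limits of maps. -/
theorem IsGLOCC.isCPTP {E : SuperOp (Modes m)} (hE : IsGLOCC m E) : IsCPTP E := by
  obtain ⟨-, p, hp, hlim⟩ := hE
  refine ⟨fun d X hX => ?_, fun X => ?_⟩
  · have hl : Filter.Tendsto (fun r => Matrix.of fun a b : Finset (Modes m) × Fin d =>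
        (p r).run (Matrix.of fun S T => X (S, a.2) (T, b.2)) a.1 b.1) Filter.atTop
        (𝓝 (ampliation E X)) := by
      refine tendsto_pi_nhds.2 fun a => tendsto_pi_nhds.2 fun b => ?_
      exact tendsto_pi_nhds.1 (tendsto_pi_nhds.1 (hlim _) a.1) b.1
    have hr (r : ℕ) := (p r).posSemidef_run hX
    refine Matrix.PosSemidef.of_dotProduct_mulVec_nonneg ?_ fun x => ?_
    · refine tendsto_nhds_unique ((continuous_id.matrix_conjTranspose.tendsto _).comp hl)
        (hl.congr fun r => (hr r).1.symm)
    · have hc : Continuous fun Y : Matrix (Finset (Modes m) × Fin d) (Finset (Modes m) × Fin d) ℂ =>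
          star x ⬝ᵥ Y *ᵥ x :=
        continuous_const.dotProduct (continuous_id.matrix_mulVec continuous_const)
      exact ge_of_tendsto ((hc.tendsto _).comp hl)
        (Filter.Eventually.of_forall fun r => (hr r).dotProduct_mulVec_nonneg x)
  · refine tendsto_nhds_unique ((continuous_id.matrix_trace.tendsto _).comp (hlim X)) ?_
    exact tendsto_const_nhds.congr fun r => ((p r).trace_run (hp r) X).symm

theorem IsGLOCC.localParity_conj {E : SuperOp (Modes m)} (hE : IsGLOCC m E) (i : Fin N)
    (ρ : Op (Modes m)) :
    E (localParity m i * ρ * localParity m i) = localParity m i * E ρ * localParity m i := by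
  obtain ⟨-, p, hp, hlim⟩ := hE
  have hc : Continuous fun Y : Op (Modes m) => localParity m i * Y * localParity m i :=
    (continuous_const.mul continuous_id).mul continuous_const
  refine tendsto_nhds_unique (hlim _) (((hc.tendsto _).comp (hlim ρ)).congr fun r => ?_)
  exact ((p r).run_localParity_conj i (hp r) ρ).symm

theorem IsGLOCC.corr_eq_zero {E : SuperOp (Modes m)} (hE : IsGLOCC m E)
    {k l : MajIdx (Modes m) ⊕ MajIdx (Modes m)}
    (hkl : party (Sum.elim Prod.fst Prod.fst k) ≠ party (Sum.elim Prod.fst Prod.fst l)) :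
    corr E k l = 0 := by
  -- The parity of the party of `k` flips the Majorana operator `k` but not `l`.
  refine corr_eq_zero_of_charOp_conj (localSign_mul_self (party (Sum.elim Prod.fst Prod.fst k)))
    (hE.localParity_conj _) ?_
  rw [localSign, if_pos rfl, localSign, if_neg (Ne.symm hkl), mul_one]

theorem IsGLOCC.isGSEP {E : SuperOp (Modes m)} (hE : IsGLOCC m E) : IsGSEP m E := by
  refine ⟨hE.isCPTP, hE.1, fun k l hkl => ?_⟩
  have h1 := hE.corr_eq_zero hkl
  have h2 := hE.corr_eq_zero (Ne.symm hkl)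
  rw [corr] at h1 h2
  rw [covariance, Matrix.of_apply, mul_sub, Matrix.trace_sub, h1, h2, sub_zero, mul_zero]

end GLOCC

end Fermion

theorem mainTheorem4 {N : ℕ} (m : Fin N → ℕ) (hm : ∀ i, m i ≤ Fermion.modesOfRest m i)
    (Ψ Φ : EuclideanSpace ℂ (Finset (Fermion.Modes m)))
    (hΨ : Fermion.IsPureFermionic Ψ) (hΨ' : Fermion.IsFullyEntangled m Ψ)
    (hΦ : Fermion.IsPureFermionic Φ) (hΦ' : Fermion.IsFullyEntangled m Φ) :
    (∀ E : Fermion.SuperOp (Fermion.Modes m), Fermion.IsGSEP m E →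
      E (Fermion.proj Ψ) = Fermion.proj Φ → Fermion.IsProductOfGLU m E) ∧
    (∀ E : Fermion.SuperOp (Fermion.Modes m), Fermion.IsGLOCC m E →
      E (Fermion.proj Ψ) = Fermion.proj Φ → Fermion.IsProductOfGLU m E) :=
  ⟨fun _ hE h => hE.isProductOfGLU hm hΨ hΦ hΦ' h,
    fun _ hE h => hE.isGSEP.isProductOfGLU hm hΨ hΦ hΦ' h⟩
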